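/- Let $m=(m_0,m_1,\dots)$ be a bounded sequence of integers $m_k\ge 2$, let $G_m=\prod_{k}\mathbb Z/m_k\mathbb Z$ be the corresponding bounded Vilenkin group with normalized Haar measure $\mu$, and put $M_0=1$, $M_{k+1}=m_kM_k$. Write $n=\sum_k n_kM_k$ with $0\le n_k<m_k$, and let $\psi_n(x)=\prod_k \exp(2\pi i\,n_kx_k/m_k)$ be the Vilenkin functions. Let $\mathcal F_n$ be the $\sigma$-algebra generated by the sets $I_n(x)=\{y: y_0=x_0,\dots,y_{n-1}=x_{n-1}\}$, $x\in G_m$. For a complex martingale $f=(f^{(k)})_{k\ge0}$ with respect to $(\mathcal F_k)$ let $\|f\|_{H_p}=\|\sup_k|f^{(k)}|\|_p$, where $\|g\|_p=(\int|g|^p\,d\mu)^{1/p}$, and let $H_p$ be the set of martingales with $\|f\|_{H_p}<\infty$. Let $\widehat f(i)=\lim_k\int f^{(k)}\overline{\psi_i}\,d\mu$, $S_nf=\sum_{i<n}\widehat f(i)\psi_i$, $\sigma_nf=\frac1n\sum_{j=1}^nS_jf$ (and likewise for integrable functions), and let $\omega(1/M_N,f)_{H_p}=\|f-S_{M_N}f\|_{H_p}$,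 where $f-S_{M_N}f$ is the martingale $(f^{(k)}-S_{M_N}f^{(k)})_k$. **Theorem.** Let $0<p\le 1/2$ and $f\in H_p$, and suppose that $$\omega\Big(\frac1{M_N},f\Big)_{H_p}=o\Big(\frac1{M_N^{1/p-2}\,N^{2[1/2+p]}}\Big)\qquad (N\to\infty),$$ where $[\cdot]$ is the integer part. Then $\|\sigma_nf-f\|_p\to0$ as $n\to\infty$, in both senses of this norm: $f^{(k)}$ converges almost everywhere to a function $f^{(\infty)}\in L_p(G_m)$ and $\|\sigma_nf-f^{(\infty)}\|_p\to0$; and $\sup_k\|\sigma_nf^{(k)}-f^{(k)}\|_p\to0$. -/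

import Mathlib

open MeasureTheory ProbabilityTheory Filter Topology
open scoped ENNReal

noncomputable section

namespace Vilenkin

/-- The Vilenkin group `G_m`: the complete direct product of the groups `ℤ / m_k`. -/
abbrev G (m : ℕ → ℕ) : Type := ∀ k : ℕ, ZMod (m k)

/-- The generalized powers `M_0 = 1`, `M_{k+1} = m_k M_k`. -/
def M (m : ℕ → ℕ) : ℕ → ℕ
  | 0 => 1
  | k + 1 => m k * M m k

/-- The `k`-th digit of `n` in the generalized number system `n = ∑ n_k M_k`, `0 ≤ n_k < m_k`. -/
def digit (m : ℕ → ℕ) (n k : ℕ) : ℕ := n / M m k % m k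

/-- The generalized Rademacher function `r_k(x) = exp(2πi x_k / m_k)`. -/
def rademacher (m : ℕ → ℕ) (k : ℕ) (x : G m) : ℂ :=
  Complex.exp (2 * Real.pi * Complex.I * ((x k).val : ℂ) / (m k : ℂ))

/-- The Vilenkin function `ψ_n = ∏_k r_k ^ n_k`. The product is finite: `n_k = 0` for `k ≥ n`
(see `digit_eq_zero`). -/
def psi (m : ℕ → ℕ) (n : ℕ) (x : G m) : ℂ :=
  ∏ k ∈ Finset.range n, rademacher m k x ^ digit m n k

theorem digit_eq_zero (m : ℕ → ℕ) (hm : ∀ k, 2 ≤ m k) {n k : ℕ} (h : n ≤ k) :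
    digit m n k = 0 := by
  have key : ∀ j, j < M m j := by
    intro j
    induction j with
    | zero => simp [M]
    | succ j ih =>
      have := hm j
      simp only [M]
      nlinarith
  simp [digit, Nat.div_eq_of_lt (h.trans_lt (key k))]

/-- The cylinder `I_n(x) = {y | y_0 = x_0, …, y_{n-1} = x_{n-1}}`. -/
def cyl (m : ℕ → ℕ) (n : ℕ) (x : G m) : Set (G m) := {y | ∀ k < n, y k = x k}

/-- The normalized Haar measure of `G_m`: the product of the uniform probability measures. -/
def haar (m : ℕ → ℕ) [∀ k, NeZero (m k)] : Measure (G m) :=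
  Measure.infinitePi fun k => uniformOn (Set.univ : Set (ZMod (m k)))

theorem measurableSet_cyl (m : ℕ → ℕ) (n : ℕ) (x : G m) : MeasurableSet (cyl m n x) := by
  have : cyl m n x = ⋂ k : ℕ, ⋂ _ : k < n, (fun y : G m => y k) ⁻¹' {x k} := by
    ext y; simp [cyl]
  rw [this]
  exact MeasurableSet.iInter fun k => MeasurableSet.iInter fun _ =>
    measurable_pi_apply k (MeasurableSet.singleton _)

theorem finite_cyl (m : ℕ → ℕ) [∀ k, NeZero (m k)] (n : ℕ) :
    {s : Set (G m) | ∃ x, s = cyl m n x}.Finite := by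
  let e : (∀ k : Fin n, ZMod (m k)) → Set (G m) := fun z => {y | ∀ k : Fin n, y k = z k}
  refine (Set.finite_range e).subset ?_
  rintro s ⟨x, rfl⟩
  refine ⟨fun k => x k, ?_⟩
  ext y
  exact ⟨fun h k hk => h ⟨k, hk⟩, fun h k => h k k.2⟩

/-- The filtration whose `n`-th σ-algebra is generated by the cylinders `I_n(x)`, `x ∈ G_m`. -/
def filt (m : ℕ → ℕ) [∀ k, NeZero (m k)] :
    Filtration ℕ (inferInstance : MeasurableSpace (G m)) where
  seq n := MeasurableSpace.generateFrom {s | ∃ x, s = cyl m n x}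
  mono' := by
    intro a b hab
    refine MeasurableSpace.generateFrom_le ?_
    rintro _ ⟨x, rfl⟩
    have h : cyl m a x = ⋃₀ {s | (∃ y, s = cyl m b y) ∧ s ⊆ cyl m a x} := by
      apply Set.Subset.antisymm
      · intro y hy
        refine ⟨cyl m b y, ⟨⟨y, rfl⟩, ?_⟩, fun _ _ => rfl⟩
        intro z hz k hk
        rw [hz k (hk.trans_le hab), hy k hk]
      · exact Set.sUnion_subset fun s hs => hs.2
    rw [h]
    refine MeasurableSet.sUnion (((finite_cyl m b).subset fun s hs => hs.1).countable) ?_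
    exact fun s hs => MeasurableSpace.measurableSet_generateFrom hs.1
  le' n := by
    refine MeasurableSpace.generateFrom_le ?_
    rintro _ ⟨x, rfl⟩
    exact measurableSet_cyl m n x

variable {m : ℕ → ℕ} [∀ k, NeZero (m k)]

/-- The Vilenkin–Fourier coefficient of an integrable function. -/
def coeff (g : G m → ℂ) (i : ℕ) : ℂ :=
  ∫ x, g x * (starRingEnd ℂ) (psi m i x) ∂haar m

/-- The `n`-th partial sum `∑_{k<n} c_k ψ_k` of the Vilenkin series with coefficients `c`. -/
def partialSum (c : ℕ → ℂ) (n : ℕ) (x : G m) : ℂ :=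
  ∑ k ∈ Finset.range n, c k * psi m k x

/-- The `n`-th Fejér mean `(1/n) ∑_{k=1}^n S_k` of the Vilenkin series with coefficients `c`. -/
def fejer (c : ℕ → ℂ) (n : ℕ) (x : G m) : ℂ :=
  (1 / (n : ℂ)) * ∑ k ∈ Finset.Icc 1 n, partialSum c k x

/-- The Vilenkin–Fourier coefficient of a martingale `f = (f^{(k)})`. -/
def martCoeff (f : ℕ → G m → ℂ) (i : ℕ) : ℂ :=
  limUnder atTop fun k => coeff (f k) i

/-- The maximal function `f^* = sup_n |f^{(n)}|`, with values in `[0, ∞]`. -/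
def maximal (f : ℕ → G m → ℂ) (x : G m) : ℝ≥0∞ := ⨆ n, ‖f n x‖ₑ

/-- `‖f‖_{H_p} = ‖f^*‖_p = (∫ (f^*)^p dμ)^{1/p}`. -/
def hpNorm (p : ℝ) (f : ℕ → G m → ℂ) : ℝ≥0∞ :=
  (∫⁻ x, maximal f x ^ p ∂haar m) ^ (1 / p)

/-- `f ∈ H_p(G_m)`. -/
def MemHp (p : ℝ) (f : ℕ → G m → ℂ) : Prop :=
  Martingale f (filt m) (haar m) ∧ hpNorm p f < ∞

/-- The modulus of continuity `ω(1/M_N, f)_{H_p} = ‖f - S_{M_N} f‖_{H_p}`; the martingale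
`f - S_{M_N} f` has the components `f^{(k)} - S_{M_N} f^{(k)}`. -/
def modulus (p : ℝ) (f : ℕ → G m → ℂ) (N : ℕ) : ℝ≥0∞ :=
  hpNorm p fun k x => f k x - partialSum (coeff (f k)) (M m N) x

/-- `‖g‖_p = (∫ |g|^p dμ)^{1/p}` for functions. -/
def lpNorm (p : ℝ) (g : G m → ℂ) : ℝ≥0∞ :=
  (∫⁻ x, ‖g x‖ₑ ^ p ∂haar m) ^ (1 / p)

/-- `‖f‖_p = sup_k ‖f^{(k)}‖_p` for martingales. -/
def martLpNorm (p : ℝ) (f : ℕ → G m → ℂ) : ℝ≥0∞ := ⨆ k, lpNorm p (f k)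

end Vilenkin

end

/-! For `p ≤ 1` the functional `‖·‖_p^p` is subadditive, and on the convolution of two functions of
the first `N` coordinates it is at most `M_N^{1-p}` times its product on the factors. Splitting off
the leading digit of `n` bounds the `L_p` quasinorms of the Fejér kernels recursively, so that for
`M_N ≤ n < M_{N+1}` the operator `σ_n` multiplies `‖·‖_p^p` by at most a constant times
`∑_{s ≤ N} (M_N / M_s)^{1-2p}`. The martingale `f - f^{(N)}` therefore contributes to
`‖σ_n f - f‖_p^p` a quantity controlled by the modulus of continuity. On `f^{(N)}` one has exactly
`σ_n f^{(N)} - f^{(N)} = (M_N / n) (σ_{M_N} f^{(N)} - f^{(N)})`; as `M_N / M_{N+1} ≤ 1/2`, these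
errors contract from each `N` to the next and tend to `0`. -/

namespace Vilenkin

section DependsOn

variable {ι β : Type*} {X : ι → Type*} {s : Set ι} {h : (∀ i, X i) → β}

theorem finite_range_of_dependsOn [Nonempty β] [∀ i, Finite (X i)] (hs : s.Finite)
    (hh : DependsOn h s) : (Set.range h).Finite := by
  have := hs.to_subtype
  obtain ⟨φ, rfl⟩ := dependsOn_iff_exists_comp.1 hh
  exact (Set.finite_range φ).subset (Set.range_comp_subset_range _ _)

variable [∀ i, MeasurableSpace (X i)] [∀ i, Countable (X i)] [∀ i, MeasurableSingletonClass (X i)]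

theorem measurable_of_dependsOn [MeasurableSpace β] [Nonempty β] (hs : s.Finite)
    (hh : DependsOn h s) : Measurable h := by
  have := hs.to_subtype
  obtain ⟨φ, rfl⟩ := dependsOn_iff_exists_comp.1 hh
  exact (measurable_of_countable φ).comp (measurable_pi_lambda _ fun i => measurable_pi_apply _)

theorem lintegral_mul_of_dependsOn (μ : ∀ i, Measure (X i)) [∀ i, IsProbabilityMeasure (μ i)]
    {S T : Finset ι} (hST : Disjoint S T) {u v : (∀ i, X i) → ℝ≥0∞}
    (hu : DependsOn u (S : Set ι)) (hv : DependsOn v (T : Set ι)) :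
    ∫⁻ x, u x * v x ∂Measure.infinitePi μ =
      (∫⁻ x, u x ∂Measure.infinitePi μ) * ∫⁻ x, v x ∂Measure.infinitePi μ := by
  obtain ⟨φ, rfl⟩ := dependsOn_iff_exists_comp.1 hu
  obtain ⟨χ, rfl⟩ := dependsOn_iff_exists_comp.1 hv
  have hind := (iIndepFun_infinitePi (P := μ) (X := fun _ z => z)
    fun _ => measurable_id).indepFun_finset S T hST measurable_pi_apply
  have hφ : Measurable φ := measurable_of_countable φ
  have hχ : Measurable χ := measurable_of_countable χ
  exact lintegral_mul_eq_lintegral_mul_lintegral_of_indepFun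
    (hφ.comp (by fun_prop)) (hχ.comp (by fun_prop)) (hind.comp hφ hχ)

end DependsOn

section Digits

variable {m : ℕ → ℕ}

theorem M_eq_prod (m : ℕ → ℕ) (n : ℕ) : M m n = ∏ k ∈ Finset.range n, m k := by
  induction n with
  | zero => simp [M]
  | succ n ih => rw [Finset.prod_range_succ, M, ih, mul_comm]

theorem M_dvd (m : ℕ → ℕ) {i j : ℕ} (h : i ≤ j) : M m i ∣ M m j := by
  rw [M_eq_prod, M_eq_prod]
  exact Finset.prod_dvd_prod_of_subset _ _ _ (Finset.range_mono h)

theorem M_succ_rpow (s : ℕ) (a : ℝ) :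
    (M m (s + 1) : ℝ≥0∞) ^ a = (m s : ℝ≥0∞) ^ a * (M m s : ℝ≥0∞) ^ a := by
  rw [M, Nat.cast_mul, ENNReal.mul_rpow_of_ne_top (by simp) (by simp)]

theorem psi_zero (x : G m) : psi m 0 x = 1 := by simp [psi]

theorem two_pow_le_M (hm : ∀ k, 2 ≤ m k) (n : ℕ) : 2 ^ n ≤ M m n := by
  simpa [M_eq_prod] using Finset.prod_le_prod' (s := Finset.range n) fun k _ => hm k

theorem exists_lt_M (hm : ∀ k, 2 ≤ m k) (n : ℕ) : ∃ N, n < M m N :=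
  ⟨n, Nat.lt_two_pow_self.trans_le (two_pow_le_M hm n)⟩

variable [∀ k, NeZero (m k)]

theorem M_pos (n : ℕ) : 0 < M m n := by
  rw [M_eq_prod]
  exact Finset.prod_pos fun _ _ => Nat.pos_of_neZero _

instance (s : ℕ) : NeZero (M m s) := ⟨(M_pos s).ne'⟩

theorem M_mono : Monotone (M m) :=
  monotone_nat_of_le_succ fun _ => Nat.le_mul_of_pos_left _ (Nat.pos_of_neZero _)

theorem M_rpow_mul_M_rpow (s : ℕ) (a b : ℝ) :
    (M m s : ℝ≥0∞) ^ a * (M m s : ℝ≥0∞) ^ b = (M m s : ℝ≥0∞) ^ (a + b) :=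
  (ENNReal.rpow_add _ _ (NeZero.ne _) (ENNReal.natCast_ne_top _)).symm

theorem digit_eq_zero_of_lt_M {n s k : ℕ} (hn : n < M m s) (hk : s ≤ k) : digit m n k = 0 := by
  simp [digit, Nat.div_eq_of_lt (hn.trans_le (M_mono hk))]

theorem psi_eq_prod (hm : ∀ k, 2 ≤ m k) {n s : ℕ} (hn : n < M m s) (x : G m) :
    psi m n x = ∏ k ∈ Finset.range s, rademacher m k x ^ digit m n k := by
  rcases le_total n s with h | h
  · refine Finset.prod_subset (Finset.range_mono h) fun k _ hk => ?_
    rw [digit_eq_zero m hm (by simpa using hk), pow_zero]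
  · refine (Finset.prod_subset (Finset.range_mono h) fun k _ hk => ?_).symm
    rw [digit_eq_zero_of_lt_M hn (by simpa using hk), pow_zero]

theorem digit_mul_M_add_self {s r k : ℕ} (hr : r < m s) (hk : k < M m s) :
    digit m (r * M m s + k) s = r := by
  rw [digit, mul_comm, Nat.mul_add_div (M_pos s), Nat.div_eq_of_lt hk, add_zero,
    Nat.mod_eq_of_lt hr]

theorem digit_mul_M_add_of_lt {s j : ℕ} (hj : j < s) (r k : ℕ) :
    digit m (r * M m s + k) j = digit m k j := by
  obtain ⟨c, hc⟩ := M_dvd m (Nat.succ_le_of_lt hj)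
  have : r * M m s + k = M m j * (m j * (r * c)) + k := by rw [hc, M]; ring
  rw [digit, digit, this, Nat.mul_add_div (M_pos j), Nat.mul_add_mod]

theorem psi_mul_M_add (hm : ∀ k, 2 ≤ m k) {s r k : ℕ} (hr : r < m s) (hk : k < M m s) (x : G m) :
    psi m (r * M m s + k) x = rademacher m s x ^ r * psi m k x := by
  have hlt : r * M m s + k < M m (s + 1) := by
    have := Nat.mul_le_mul_right (M m s) (Nat.succ_le_of_lt hr)
    simp only [M]
    linarith
  rw [psi_eq_prod hm hlt, psi_eq_prod hm hk, Finset.prod_range_succ, mul_comm,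
    digit_mul_M_add_self hr hk]
  congr 1
  exact Finset.prod_congr rfl fun j hj => by rw [digit_mul_M_add_of_lt (Finset.mem_range.1 hj)]

theorem dependsOn_psi (hm : ∀ k, 2 ≤ m k) {n s : ℕ} (hn : n < M m s) :
    DependsOn (psi m n) (Set.Iio s) := by
  intro x y hxy
  rw [psi_eq_prod hm hn, psi_eq_prod hm hn]
  refine Finset.prod_congr rfl fun k hk => ?_
  rw [rademacher, rademacher, hxy k (Finset.mem_range.1 hk)]

end Digits

section Characters

variable {m : ℕ → ℕ} [∀ k, NeZero (m k)]

theorem rademacher_eq_stdAddChar (k : ℕ) (x : G m) :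
    rademacher m k x = ZMod.stdAddChar (x k) := by
  rw [ZMod.stdAddChar_apply, ZMod.toCircle_apply]
  rfl

theorem norm_rademacher (k : ℕ) (x : G m) : ‖rademacher m k x‖ = 1 := by
  rw [rademacher_eq_stdAddChar, ZMod.stdAddChar_apply, Circle.norm_coe]

theorem rademacher_sub (k : ℕ) (x y : G m) :
    rademacher m k (x - y) = rademacher m k x * (starRingEnd ℂ) (rademacher m k y) := by
  rw [← Complex.inv_eq_conj (norm_rademacher k y)]
  simp only [rademacher_eq_stdAddChar, Pi.sub_apply, AddChar.map_sub_eq_div, div_eq_mul_inv]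

theorem norm_psi (n : ℕ) (x : G m) : ‖psi m n x‖ = 1 := by
  simp [psi, norm_prod, norm_pow, norm_rademacher]

theorem psi_sub (n : ℕ) (x y : G m) :
    psi m n (x - y) = psi m n x * (starRingEnd ℂ) (psi m n y) := by
  simp only [psi, rademacher_sub, mul_pow, Finset.prod_mul_distrib, map_prod, map_pow]

@[fun_prop]
theorem measurable_psi (n : ℕ) : Measurable (psi m n) := by
  refine measurable_of_dependsOn (Set.finite_Iio n) fun x y hxy => ?_
  refine Finset.prod_congr rfl fun k hk => ?_
  rw [rademacher, rademacher, hxy k (Finset.mem_range.1 hk)]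

theorem sum_rademacher_pow (s : ℕ) (x : G m) :
    ∑ r ∈ Finset.range (m s), rademacher m s x ^ r = if x s = 0 then (m s : ℂ) else 0 := by
  rw [rademacher_eq_stdAddChar]
  split_ifs with hx
  · simp [hx]
  · have h1 : ZMod.stdAddChar (x s) ≠ 1 := by
      rw [← AddChar.map_zero_eq_one (ZMod.stdAddChar (N := m s))]
      exact fun h => hx (ZMod.injective_stdAddChar h)
    have h2 : ZMod.stdAddChar (x s) ^ m s = 1 := by
      rw [← AddChar.map_nsmul_eq_pow]; simp
    rw [geom_sum_eq h1, h2, sub_self, zero_div]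

end Characters

section Haar

variable {m : ℕ → ℕ} [∀ k, NeZero (m k)]

instance : IsProbabilityMeasure (haar m) := by
  unfold haar; infer_instance

instance : (haar m).IsAddRightInvariant where
  map_add_right_eq_self a := by
    have hmap (k : ℕ) : (uniformOn (Set.univ : Set (ZMod (m k)))).map (· + a k) =
        uniformOn Set.univ := by
      rw [uniformOn, ProbabilityTheory.cond, Measure.restrict_univ, Measure.map_smul,
        map_add_right_eq_self]
    rw [haar]
    refine (Measure.infinitePi_map_pi _ fun k => measurable_of_countable (· + a k)).trans ?_
    simp only [hmap]

theorem haar_cyl (n : ℕ) (x : G m) : haar m (cyl m n x) = (M m n : ℝ≥0∞)⁻¹ := by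
  have h1 (k : ℕ) : uniformOn (Set.univ : Set (ZMod (m k))) {x k} = (m k : ℝ≥0∞)⁻¹ := by
    rw [uniformOn_univ]; simp [ZMod.card]
  have hcyl : cyl m n x = Set.pi (Finset.range n : Set ℕ) fun k => {x k} := by
    ext y; simp [cyl, Set.mem_pi]
  rw [hcyl, haar, Measure.infinitePi_pi _ fun k _ => MeasurableSet.singleton _, M_eq_prod,
    Nat.cast_prod, Finset.prod_congr rfl fun k _ => h1 k,
    ENNReal.prod_inv_distrib (by simp [Set.Pairwise])]

theorem integrable_of_dependsOn {n : ℕ} {h : G m → ℂ} (hh : DependsOn h (Set.Iio n)) :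
    Integrable h (haar m) := by
  have hfin := (finite_range_of_dependsOn (Set.finite_Iio n) hh).isBounded
  obtain ⟨C, hC⟩ := hfin.exists_norm_le
  exact .of_bound (measurable_of_dependsOn (Set.finite_Iio n) hh).aestronglyMeasurable C
    (.of_forall fun x => hC _ ⟨x, rfl⟩)

end Haar

section Kernels

variable {m : ℕ → ℕ}

theorem mem_cyl_succ {s : ℕ} {x y : G m} :
    y ∈ cyl m (s + 1) x ↔ y ∈ cyl m s x ∧ y s = x s := by
  simp only [cyl, Set.mem_ofPred_eq, Nat.forall_lt_succ_right]

theorem sub_mem_cyl_zero {s : ℕ} {x y : G m} : x - y ∈ cyl m s 0 ↔ y ∈ cyl m s x := by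
  simp only [cyl, Set.mem_ofPred_eq, Pi.sub_apply, Pi.zero_apply, sub_eq_zero, eq_comm]

theorem dependsOn_sum_rademacher_pow (s r : ℕ) :
    DependsOn (fun x : G m => ∑ q ∈ Finset.range r, rademacher m s x ^ q) {s} := by
  intro x y hxy
  simp only [rademacher, hxy s rfl]

/-- The Dirichlet kernel `D_n = ∑_{k<n} ψ_k`. -/
noncomputable def dirichletKernel (m : ℕ → ℕ) (n : ℕ) (x : G m) : ℂ :=
  ∑ k ∈ Finset.range n, psi m k x

/-- The unnormalized Fejér kernel `n K_n = ∑_{k=1}^n D_k`, so that `σ_n g = n⁻¹ (g * n K_n)`. -/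
noncomputable def fejerKernel (m : ℕ → ℕ) (n : ℕ) (x : G m) : ℂ :=
  ∑ k ∈ Finset.range n, dirichletKernel m (k + 1) x

theorem fejerKernel_one (x : G m) : fejerKernel m 1 x = 1 := by
  simp [fejerKernel, dirichletKernel, psi_zero]

variable [∀ k, NeZero (m k)]

@[fun_prop]
theorem measurable_dirichletKernel (n : ℕ) : Measurable (dirichletKernel m n) := by
  unfold dirichletKernel; fun_prop

@[fun_prop]
theorem measurable_fejerKernel (n : ℕ) : Measurable (fejerKernel m n) := by
  unfold fejerKernel; fun_prop

theorem dependsOn_dirichletKernel (hm : ∀ k, 2 ≤ m k) {n s : ℕ} (hn : n ≤ M m s) :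
    DependsOn (dirichletKernel m n) (Set.Iio s) := fun _ _ hxy =>
  Finset.sum_congr rfl fun _ hk => dependsOn_psi hm ((Finset.mem_range.1 hk).trans_le hn) hxy

theorem dependsOn_fejerKernel (hm : ∀ k, 2 ≤ m k) {n s : ℕ} (hn : n ≤ M m s) :
    DependsOn (fejerKernel m n) (Set.Iio s) := fun _ _ hxy =>
  Finset.sum_congr rfl fun _ hk =>
    dependsOn_dirichletKernel hm ((Nat.succ_le_of_lt (Finset.mem_range.1 hk)).trans hn) hxy

theorem dirichletKernel_mul_M_add (hm : ∀ k, 2 ≤ m k) {s r k : ℕ} (hr : r < m s)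
    (hk : k ≤ M m s) (x : G m) :
    dirichletKernel m (r * M m s + k) x =
      dirichletKernel m (r * M m s) x + rademacher m s x ^ r * dirichletKernel m k x := by
  simp only [dirichletKernel]
  rw [Finset.sum_range_add, Finset.mul_sum]
  congr 1
  exact Finset.sum_congr rfl fun j hj =>
    psi_mul_M_add hm hr ((Finset.mem_range.1 hj).trans_le hk) x

theorem dirichletKernel_mul_M (hm : ∀ k, 2 ≤ m k) {s r : ℕ} (hr : r ≤ m s) (x : G m) :
    dirichletKernel m (r * M m s) x =
      (∑ q ∈ Finset.range r, rademacher m s x ^ q) * dirichletKernel m (M m s) x := by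
  induction r with
  | zero => simp [dirichletKernel]
  | succ r ih =>
    rw [Nat.succ_mul, dirichletKernel_mul_M_add hm hr le_rfl, ih (by omega),
      Finset.sum_range_succ]
    ring

theorem fejerKernel_mul_M_add (hm : ∀ k, 2 ≤ m k) {s r k : ℕ} (hr : r < m s)
    (hk : k ≤ M m s) (x : G m) :
    fejerKernel m (r * M m s + k) x = fejerKernel m (r * M m s) x +
      k * dirichletKernel m (r * M m s) x + rademacher m s x ^ r * fejerKernel m k x := by
  have hD : ∀ j ∈ Finset.range k, dirichletKernel m (r * M m s + j + 1) x =
      dirichletKernel m (r * M m s) x + rademacher m s x ^ r * dirichletKernel m (j + 1) x :=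
    fun j hj => dirichletKernel_mul_M_add hm hr ((Finset.mem_range.1 hj).trans_le hk) x
  simp only [fejerKernel]
  rw [Finset.sum_range_add, Finset.sum_congr rfl hD, Finset.sum_add_distrib, Finset.mul_sum]
  simp [add_assoc]

theorem fejerKernel_mul_M (hm : ∀ k, 2 ≤ m k) {s r : ℕ} (hr : r ≤ m s) (x : G m) :
    fejerKernel m (r * M m s) x =
      M m s * ∑ q ∈ Finset.range r, dirichletKernel m (q * M m s) x +
        (∑ q ∈ Finset.range r, rademacher m s x ^ q) * fejerKernel m (M m s) x := by
  induction r with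
  | zero => simp [fejerKernel]
  | succ r ih =>
    rw [Nat.succ_mul, fejerKernel_mul_M_add hm hr le_rfl, ih (by omega), Finset.sum_range_succ,
      Finset.sum_range_succ]
    ring

theorem dirichletKernel_M (hm : ∀ k, 2 ≤ m k) (s : ℕ) (x : G m) :
    dirichletKernel m (M m s) x = (cyl m s 0).indicator (fun _ => (M m s : ℂ)) x := by
  classical
  induction s with
  | zero => simp [M, dirichletKernel, psi_zero, cyl]
  | succ s ih =>
    rw [M, dirichletKernel_mul_M hm le_rfl, sum_rademacher_pow, ih]
    simp only [Set.indicator_apply, mem_cyl_succ, Pi.zero_apply]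
    split_ifs <;> simp_all

end Kernels

section PartialSums

variable {m : ℕ → ℕ}

theorem fejer_eq_sum_range (c : ℕ → ℂ) (n : ℕ) (x : G m) :
    fejer c n x = (n : ℂ)⁻¹ * ∑ k ∈ Finset.range n, partialSum c (k + 1) x := by
  rw [fejer, one_div, Finset.range_eq_Ico, Finset.sum_Ico_add' (fun k => partialSum c k x) 0 n 1]
  rfl

theorem fejer_congr {c d : ℕ → ℂ} {n : ℕ} (h : ∀ i < n, c i = d i) (x : G m) :
    fejer c n x = fejer d n x := by
  simp only [fejer_eq_sum_range, partialSum]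
  congr 1
  refine Finset.sum_congr rfl fun k hk => Finset.sum_congr rfl fun i hi => ?_
  rw [h i (by have := Finset.mem_range.1 hk; have := Finset.mem_range.1 hi; omega)]

variable [∀ k, NeZero (m k)]

@[fun_prop]
theorem measurable_fejer (c : ℕ → ℂ) (n : ℕ) : Measurable (fejer (m := m) c n) := by
  unfold fejer partialSum; fun_prop

theorem integrable_mul_conj_psi {g : G m → ℂ} (hg : Integrable g (haar m)) (i : ℕ) :
    Integrable (fun x => g x * (starRingEnd ℂ) (psi m i x)) (haar m) :=
  hg.mul_bdd (c := 1) (Complex.continuous_conj.measurable.comp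
    (measurable_psi i)).aestronglyMeasurable (.of_forall fun x => by simp [norm_psi])

theorem coeff_sub {g h : G m → ℂ} (hg : Integrable g (haar m)) (hh : Integrable h (haar m))
    (i : ℕ) : coeff (fun x => g x - h x) i = coeff g i - coeff h i := by
  simp only [coeff, sub_mul]
  exact integral_sub (integrable_mul_conj_psi hg i) (integrable_mul_conj_psi hh i)

theorem partialSum_coeff_sub {g h : G m → ℂ} (hg : Integrable g (haar m))
    (hh : Integrable h (haar m)) (n : ℕ) (x : G m) :
    partialSum (coeff fun x => g x - h x) n x =
      partialSum (coeff g) n x - partialSum (coeff h) n x := by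
  simp only [partialSum, coeff_sub hg hh, sub_mul, Finset.sum_sub_distrib]

theorem fejer_coeff_sub {g h : G m → ℂ} (hg : Integrable g (haar m)) (hh : Integrable h (haar m))
    (n : ℕ) (x : G m) :
    fejer (coeff fun x => g x - h x) n x = fejer (coeff g) n x - fejer (coeff h) n x := by
  simp only [fejer, partialSum_coeff_sub hg hh, Finset.sum_sub_distrib, mul_sub]

theorem mul_psi_sub (g : G m → ℂ) (i : ℕ) (x t : G m) :
    g t * psi m i (x - t) = g t * (starRingEnd ℂ) (psi m i t) * psi m i x := by
  rw [psi_sub]; ring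

theorem integrable_mul_dirichletKernel {g : G m → ℂ} (hg : Integrable g (haar m)) (n : ℕ)
    (x : G m) : Integrable (fun t => g t * dirichletKernel m n (x - t)) (haar m) := by
  simp only [dirichletKernel, Finset.mul_sum, mul_psi_sub]
  exact integrable_finsetSum _ fun k _ => (integrable_mul_conj_psi hg k).mul_const _

theorem partialSum_coeff_eq_integral {g : G m → ℂ} (hg : Integrable g (haar m)) (n : ℕ)
    (x : G m) : partialSum (coeff g) n x = ∫ t, g t * dirichletKernel m n (x - t) ∂haar m := by
  simp only [dirichletKernel, Finset.mul_sum, mul_psi_sub]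
  rw [integral_finsetSum _ fun k _ => (integrable_mul_conj_psi hg k).mul_const _]
  exact Finset.sum_congr rfl fun k _ => (integral_mul_const _ _).symm

theorem fejer_coeff_eq_integral {g : G m → ℂ} (hg : Integrable g (haar m)) (n : ℕ) (x : G m) :
    fejer (coeff g) n x = (n : ℂ)⁻¹ * ∫ t, g t * fejerKernel m n (x - t) ∂haar m := by
  simp only [fejer_eq_sum_range, fejerKernel, Finset.mul_sum]
  rw [integral_finsetSum _ fun k _ => integrable_mul_dirichletKernel hg _ x, Finset.mul_sum]
  exact Finset.sum_congr rfl fun k _ => by rw [partialSum_coeff_eq_integral hg]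

theorem partialSum_M_eq_setIntegral (hm : ∀ k, 2 ≤ m k) {g : G m → ℂ}
    (hg : Integrable g (haar m)) (N : ℕ) (x : G m) :
    partialSum (coeff g) (M m N) x = M m N * ∫ t in cyl m N x, g t ∂haar m := by
  rw [partialSum_coeff_eq_integral hg, ← integral_indicator (measurableSet_cyl m N x),
    ← integral_const_mul]
  refine integral_congr_ae (.of_forall fun t => ?_)
  by_cases h : t ∈ cyl m N x
  · simp only [dirichletKernel_M hm, Set.indicator_of_mem (sub_mem_cyl_zero.2 h),
      Set.indicator_of_mem h, mul_comm]
  · simp [dirichletKernel_M hm, h, sub_mem_cyl_zero]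

theorem partialSum_M_eq_self (hm : ∀ k, 2 ≤ m k) {N : ℕ} {g : G m → ℂ}
    (hg : DependsOn g (Set.Iio N)) : partialSum (coeff g) (M m N) = g := by
  funext x
  rw [partialSum_M_eq_setIntegral hm (integrable_of_dependsOn hg),
    setIntegral_congr_fun (measurableSet_cyl m N x) (g := fun _ => g x) fun y hy => hg hy,
    setIntegral_const, Measure.real, haar_cyl, Complex.real_smul]
  simp [(M_pos N).ne']

theorem integrable_psi (n : ℕ) : Integrable (psi m n) (haar m) :=
  .of_bound (measurable_psi n).aestronglyMeasurable 1 (.of_forall fun x => (norm_psi n x).le)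

theorem coeff_partialSum_eq_sum (c : ℕ → ℂ) (n i : ℕ) :
    coeff (m := m) (partialSum c n) i = ∑ k ∈ Finset.range n, c k * coeff (psi m k) i := by
  simp only [coeff, partialSum, Finset.sum_mul, mul_assoc]
  rw [integral_finsetSum _ fun k _ => (integrable_mul_conj_psi (integrable_psi k) i).const_mul _]
  exact Finset.sum_congr rfl fun k _ => integral_const_mul _ _

theorem coeff_psi_self (n : ℕ) : coeff (psi m n) n = 1 := by
  simp [coeff, Complex.mul_conj', norm_psi]

theorem coeff_psi_swap (n i : ℕ) :
    coeff (psi m i) n = (starRingEnd ℂ) (coeff (psi m n) i) := by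
  simp only [coeff, ← integral_conj, map_mul, Complex.conj_conj, mul_comm]

-- Since `ψ_n = S_{M_N} ψ_n` for large `N`, `∑_{k < M_N} |⟨ψ_n, ψ_k⟩|² = ⟨ψ_n, ψ_n⟩ = 1`, and the
-- term `k = n` already accounts for all of it.
theorem coeff_psi_of_ne (hm : ∀ k, 2 ≤ m k) {n i : ℕ} (h : i ≠ n) : coeff (psi m n) i = 0 := by
  obtain ⟨N, hN⟩ := exists_lt_M hm (max n i)
  obtain ⟨hn, hi⟩ := max_lt_iff.1 hN
  have hsum : ∑ k ∈ Finset.range (M m N), ‖coeff (psi m n) k‖ ^ 2 = 1 := by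
    have hk (k : ℕ) : coeff (psi m n) k * coeff (psi m k) n = ‖coeff (psi m n) k‖ ^ 2 := by
      rw [coeff_psi_swap n k, Complex.mul_conj']
    have := coeff_partialSum_eq_sum (m := m) (coeff (psi m n)) (M m N) n
    simp only [partialSum_M_eq_self hm (dependsOn_psi hm hn), coeff_psi_self, hk] at this
    exact_mod_cast this.symm
  have hle : ‖coeff (psi m n) n‖ ^ 2 + ‖coeff (psi m n) i‖ ^ 2 ≤ 1 := by
    rw [← hsum, ← Finset.sum_pair (f := fun k => ‖coeff (psi m n) k‖ ^ 2) h.symm]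
    refine Finset.sum_le_sum_of_subset_of_nonneg ?_ fun _ _ _ => by positivity
    simp [Finset.insert_subset_iff, hn, hi]
  rw [coeff_psi_self, norm_one, one_pow, add_le_iff_nonpos_right] at hle
  simpa using hle.antisymm (by positivity)

theorem coeff_partialSum (hm : ∀ k, 2 ≤ m k) (c : ℕ → ℂ) (n i : ℕ) :
    coeff (m := m) (partialSum c n) i = if i < n then c i else 0 := by
  have (k : ℕ) : c k * coeff (psi m k) i = if i = k then c k else 0 := by
    split_ifs with h
    · rw [h, coeff_psi_self, mul_one]
    · rw [coeff_psi_of_ne hm h, mul_zero]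
  simp [coeff_partialSum_eq_sum, this]

theorem partialSum_eq_self (hm : ∀ k, 2 ≤ m k) {N : ℕ} {g : G m → ℂ}
    (hg : DependsOn g (Set.Iio N)) {n : ℕ} (hn : M m N ≤ n) : partialSum (coeff g) n = g := by
  refine Eq.trans (funext fun x => ?_) (partialSum_M_eq_self hm hg)
  refine (Finset.sum_subset (Finset.range_mono hn) fun k _ hk => ?_).symm
  rw [← partialSum_M_eq_self hm hg, coeff_partialSum hm, if_neg (by simpa using hk), zero_mul]

theorem fejer_coeff_sub_self (hm : ∀ k, 2 ≤ m k) {N : ℕ} {g : G m → ℂ}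
    (hg : DependsOn g (Set.Iio N)) {n : ℕ} (hn : M m N ≤ n) (x : G m) :
    fejer (coeff g) n x - g x = (M m N / n : ℂ) * (fejer (coeff g) (M m N) x - g x) := by
  have hM : (M m N : ℂ) ≠ 0 := NeZero.ne _
  have hn0 : (n : ℂ) ≠ 0 := by exact_mod_cast ((M_pos N).trans_le hn).ne'
  have : ∑ k ∈ Finset.Ico (M m N) n, partialSum (coeff g) (k + 1) x = (n - M m N : ℂ) * g x := by
    rw [Finset.sum_congr rfl fun k hk => congrFun (partialSum_eq_self hm hg
      ((Finset.mem_Ico.1 hk).1.trans (Nat.le_succ k))) x]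
    simp [Nat.cast_sub hn]
  rw [fejer_eq_sum_range, fejer_eq_sum_range, ← Finset.sum_range_add_sum_Ico _ hn, this]
  field_simp
  ring

end PartialSums

section LpPow

variable {m : ℕ → ℕ} [∀ k, NeZero (m k)] {p : ℝ}

/-- The `p`-th power `∫ |g|^p dμ` of `‖g‖_p`, which for `p ≤ 1` is subadditive in `g`. -/
noncomputable def lpPow (p : ℝ) (g : G m → ℂ) : ℝ≥0∞ := ∫⁻ x, ‖g x‖ₑ ^ p ∂haar m

theorem lpPow_zero (hp0 : 0 < p) : lpPow (m := m) p 0 = 0 := by simp [lpPow, hp0]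

theorem lpPow_add_le (hp0 : 0 ≤ p) (hp1 : p ≤ 1) {g : G m → ℂ} (hg : Measurable g)
    (h : G m → ℂ) : lpPow p (fun x => g x + h x) ≤ lpPow p g + lpPow p h := by
  rw [lpPow, lpPow, lpPow, ← lintegral_add_left (by fun_prop)]
  refine lintegral_mono fun x => ?_
  calc ‖g x + h x‖ₑ ^ p ≤ (‖g x‖ₑ + ‖h x‖ₑ) ^ p := by gcongr; exact enorm_add_le _ _
    _ ≤ _ := ENNReal.rpow_add_le_add_rpow _ _ hp0 hp1

theorem lpPow_neg (p : ℝ) (g : G m → ℂ) : lpPow p (fun x => -g x) = lpPow p g := by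
  simp [lpPow]

theorem lpPow_sub_le (hp0 : 0 ≤ p) (hp1 : p ≤ 1) {g : G m → ℂ} (hg : Measurable g)
    (h : G m → ℂ) : lpPow p (fun x => g x - h x) ≤ lpPow p g + lpPow p h := by
  simpa only [sub_eq_add_neg, lpPow_neg] using lpPow_add_le hp0 hp1 hg fun x => -h x

theorem lpPow_sum_le (hp0 : 0 < p) (hp1 : p ≤ 1) {g : ℕ → G m → ℂ}
    (hg : ∀ i, Measurable (g i)) (n : ℕ) :
    lpPow p (fun x => ∑ i ∈ Finset.range n, g i x) ≤ ∑ i ∈ Finset.range n, lpPow p (g i) := by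
  induction n with
  | zero => exact (lpPow_zero hp0).le
  | succ n ih =>
    simp only [Finset.sum_range_succ]
    exact (lpPow_add_le hp0.le hp1 (by fun_prop) _).trans (by gcongr)

theorem lpPow_mul_le (hp0 : 0 ≤ p) {u : G m → ℂ} {c : ℝ≥0∞} (hc : c ≠ ∞)
    (hu : ∀ x, ‖u x‖ₑ ≤ c) (g : G m → ℂ) :
    lpPow p (fun x => u x * g x) ≤ c ^ p * lpPow p g := by
  rw [lpPow, lpPow, ← lintegral_const_mul' _ _ (ENNReal.rpow_ne_top_of_nonneg hp0 hc)]
  refine lintegral_mono fun x => ?_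
  rw [enorm_mul, ENNReal.mul_rpow_of_nonneg _ _ hp0]
  gcongr
  exact hu x

theorem lpPow_const_mul (hp0 : 0 ≤ p) (c : ℂ) (g : G m → ℂ) :
    lpPow p (fun x => c * g x) = ‖c‖ₑ ^ p * lpPow p g := by
  simp only [lpPow, enorm_mul, ENNReal.mul_rpow_of_nonneg _ _ hp0]
  exact lintegral_const_mul' _ _ (ENNReal.rpow_ne_top_of_nonneg hp0 enorm_ne_top)

theorem lpPow_mul_of_dependsOn (hp0 : 0 ≤ p) {s : ℕ} {u v : G m → ℂ}
    (hu : DependsOn u {s}) (hv : DependsOn v (Set.Iio s)) :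
    lpPow p (fun x => u x * v x) = lpPow p u * lpPow p v := by
  simp only [lpPow, enorm_mul, ENNReal.mul_rpow_of_nonneg _ _ hp0]
  refine lintegral_mul_of_dependsOn _ (S := {s}) (T := Finset.range s) (by simp) ?_ ?_
  · intro x y hxy
    simp only [hu (by simpa using hxy)]
  · intro x y hxy
    simp only [hv (by simpa using hxy)]

end LpPow

section KernelEstimates

variable {m : ℕ → ℕ} [∀ k, NeZero (m k)] {p : ℝ}

theorem lpPow_rademacher_pow_mul (p : ℝ) (s r : ℕ) (g : G m → ℂ) :
    lpPow p (fun x => rademacher m s x ^ r * g x) = lpPow p g := by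
  simp [lpPow, ← ofReal_norm, norm_rademacher]

theorem enorm_sum_rademacher_pow_le (s : ℕ) {r n : ℕ} (hr : r ≤ n) (x : G m) :
    ‖∑ q ∈ Finset.range r, rademacher m s x ^ q‖ₑ ≤ n := by
  refine (enorm_sum_le _ _).trans ?_
  simpa [← ofReal_norm, norm_rademacher] using hr

theorem lpPow_dirichletKernel_M (hm : ∀ k, 2 ≤ m k) (hp0 : 0 < p) (s : ℕ) :
    lpPow p (dirichletKernel m (M m s)) = (M m s : ℝ≥0∞) ^ (p - 1) := by
  have (x : G m) : ‖dirichletKernel m (M m s) x‖ₑ ^ p =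
      (cyl m s 0).indicator (fun _ => (M m s : ℝ≥0∞) ^ p) x := by
    rw [dirichletKernel_M hm]
    by_cases h : x ∈ cyl m s 0 <;> simp [h, hp0, ← ofReal_norm]
  simp only [lpPow, this]
  rw [lintegral_indicator_const (measurableSet_cyl m s 0), haar_cyl, ← ENNReal.rpow_neg_one,
    M_rpow_mul_M_rpow, ← sub_eq_add_neg]

-- Both sides become `‖D_{M_{s+1}}‖_p^p` when multiplied by `‖D_{M_s}‖_p^p`.
theorem lpPow_sum_rademacher_pow (hm : ∀ k, 2 ≤ m k) (hp0 : 0 < p) (s : ℕ) :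
    lpPow p (fun x => ∑ q ∈ Finset.range (m s), rademacher m s x ^ q) =
      (m s : ℝ≥0∞) ^ (p - 1) := by
  have hD := lpPow_mul_of_dependsOn hp0.le (dependsOn_sum_rademacher_pow (m := m) s (m s))
    (dependsOn_dirichletKernel hm (le_refl (M m s)))
  rw [← funext (dirichletKernel_mul_M hm le_rfl), ← M, lpPow_dirichletKernel_M hm hp0,
    lpPow_dirichletKernel_M hm hp0, M_succ_rpow] at hD
  refine ((ENNReal.mul_left_inj ?_ ?_).1 hD).symm
  · simp [ENNReal.rpow_eq_zero_iff, (M_pos s).ne']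
  · simp [ENNReal.rpow_eq_top_iff, (M_pos s).ne']

theorem lpPow_dirichletKernel_mul_M_le (hm : ∀ k, 2 ≤ m k) (hp0 : 0 < p) {s r : ℕ}
    (hr : r ≤ m s) :
    lpPow p (dirichletKernel m (r * M m s)) ≤ (m s : ℝ≥0∞) ^ p * (M m s : ℝ≥0∞) ^ (p - 1) := by
  rw [← lpPow_dirichletKernel_M hm hp0, funext (dirichletKernel_mul_M hm hr)]
  exact lpPow_mul_le hp0.le (by simp) (enorm_sum_rademacher_pow_le s hr) _

theorem lpPow_fejerKernel_mul_M_le (hm : ∀ k, 2 ≤ m k) (hp0 : 0 < p) (hp1 : p ≤ 1)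
    {s r : ℕ} (hr : r ≤ m s) :
    lpPow p (fejerKernel m (r * M m s)) ≤
      (m s : ℝ≥0∞) ^ (1 + p) * (M m s : ℝ≥0∞) ^ (2 * p - 1) +
        lpPow p fun x => (∑ q ∈ Finset.range r, rademacher m s x ^ q) *
          fejerKernel m (M m s) x := by
  rw [funext (fejerKernel_mul_M hm hr)]
  refine (lpPow_add_le hp0.le hp1 (by fun_prop) _).trans (add_le_add_left ?_ _)
  rw [lpPow_const_mul hp0.le]
  calc _ ≤ (M m s : ℝ≥0∞) ^ p *
        ∑ q ∈ Finset.range r, lpPow p (dirichletKernel m (q * M m s)) := by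
        gcongr
        · simp [← ofReal_norm]
        · exact lpPow_sum_le hp0 hp1 (fun q => by fun_prop) r
    _ ≤ (M m s : ℝ≥0∞) ^ p *
        (m s * ((m s : ℝ≥0∞) ^ p * (M m s : ℝ≥0∞) ^ (p - 1))) := by
        gcongr
        refine (Finset.sum_le_card_nsmul _ _ _ fun q hq =>
          lpPow_dirichletKernel_mul_M_le hm hp0 ((Finset.mem_range.1 hq).le.trans hr)).trans ?_
        rw [Finset.card_range, nsmul_eq_mul]
        gcongr
    _ = _ := by
        rw [ENNReal.rpow_add _ _ (NeZero.ne _) (by simp), ENNReal.rpow_one,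
          show 2 * p - 1 = p + (p - 1) by ring, ← M_rpow_mul_M_rpow]
        ring

theorem lpPow_fejerKernel_M_succ_le (hm : ∀ k, 2 ≤ m k) (hp0 : 0 < p) (hp1 : p ≤ 1)
    (s : ℕ) : lpPow p (fejerKernel m (M m (s + 1))) ≤
      (m s : ℝ≥0∞) ^ (1 + p) * (M m s : ℝ≥0∞) ^ (2 * p - 1) +
        (m s : ℝ≥0∞) ^ (p - 1) * lpPow p (fejerKernel m (M m s)) := by
  refine (lpPow_fejerKernel_mul_M_le hm hp0 hp1 le_rfl).trans_eq ?_
  rw [lpPow_mul_of_dependsOn hp0.le (dependsOn_sum_rademacher_pow s _)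
    (dependsOn_fejerKernel hm le_rfl), lpPow_sum_rademacher_pow hm hp0]

theorem exists_add_mul_le {q a b : ℝ≥0∞} (hq : q < 1) (ha : a ≠ ∞) (hb : b ≠ ∞) :
    ∃ B, B ≠ ∞ ∧ b ≤ B ∧ a + q * B ≤ B := by
  have h0 : 1 - q ≠ 0 := (tsub_pos_of_lt hq).ne'
  have hinv : 1 ≤ (1 - q)⁻¹ := ENNReal.one_le_inv.2 tsub_le_self
  refine ⟨(1 - q)⁻¹ * (a + b), by finiteness, ?_, ?_⟩
  · exact le_add_self.trans (le_mul_of_one_le_left' hinv)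
  · calc a + q * ((1 - q)⁻¹ * (a + b)) ≤ (a + b) + q * ((1 - q)⁻¹ * (a + b)) := by
          gcongr; exact le_self_add
      _ = (1 - q) * ((1 - q)⁻¹ * (a + b)) + q * ((1 - q)⁻¹ * (a + b)) := by
          rw [← mul_assoc (1 - q), ENNReal.mul_inv_cancel h0 (by finiteness), one_mul]
      _ = (1 - q)⁻¹ * (a + b) := by rw [← add_mul, tsub_add_cancel_of_le hq.le, one_mul]

theorem two_rpow_neg_lt_one (hp0 : 0 < p) : (2 : ℝ≥0∞) ^ (-p) < 1 :=
  ENNReal.rpow_lt_one_of_one_lt_of_neg (by simp) (by linarith)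

theorem exists_lpPow_fejerKernel_M_le (hm : ∀ k, 2 ≤ m k) (hbdd : ∃ C : ℕ, ∀ k, m k ≤ C)
    (hp0 : 0 < p) (hp1 : p ≤ 1) :
    ∃ B : ℝ≥0∞, B ≠ ∞ ∧
      ∀ s, lpPow p (fejerKernel m (M m s)) ≤ B * (M m s : ℝ≥0∞) ^ (2 * p - 1) := by
  obtain ⟨C, hC⟩ := hbdd
  obtain ⟨B, hB, hB1, hrec⟩ := exists_add_mul_le (a := (C : ℝ≥0∞) ^ (2 - p))
    (two_rpow_neg_lt_one hp0) (ENNReal.rpow_ne_top_of_nonneg (by linarith) (by simp))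
    ENNReal.one_ne_top
  refine ⟨B, hB, fun s => ?_⟩
  induction s with
  | zero => simpa [M, lpPow, fejerKernel_one] using hB1
  | succ s ih =>
    have hms : (m s : ℝ≥0∞) ≠ 0 := NeZero.ne _
    have hcoeff : (m s : ℝ≥0∞) ^ (2 - p) + (m s : ℝ≥0∞) ^ (-p) * B ≤ B := by
      refine le_trans ?_ hrec
      gcongr ?_ + ?_ * B
      · exact ENNReal.rpow_le_rpow (by exact_mod_cast hC s) (by linarith)
      · rw [ENNReal.rpow_neg, ENNReal.rpow_neg]
        gcongr
        exact_mod_cast hm s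
    calc _ ≤ (m s : ℝ≥0∞) ^ (1 + p) * (M m s : ℝ≥0∞) ^ (2 * p - 1) +
          (m s : ℝ≥0∞) ^ (p - 1) * (B * (M m s : ℝ≥0∞) ^ (2 * p - 1)) :=
          (lpPow_fejerKernel_M_succ_le hm hp0 hp1 s).trans (by gcongr)
      _ = ((m s : ℝ≥0∞) ^ (2 - p) + (m s : ℝ≥0∞) ^ (-p) * B) *
          (M m (s + 1) : ℝ≥0∞) ^ (2 * p - 1) := by
          rw [M_succ_rpow, show 1 + p = (2 - p) + (2 * p - 1) by ring,
            show p - 1 = -p + (2 * p - 1) by ring,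
            ENNReal.rpow_add _ _ hms (by simp), ENNReal.rpow_add _ _ hms (by simp)]
          ring
      _ ≤ B * (M m (s + 1) : ℝ≥0∞) ^ (2 * p - 1) := by gcongr

theorem lpPow_fejerKernel_mul_M_add_le (hm : ∀ k, 2 ≤ m k) (hp0 : 0 < p) (hp1 : p ≤ 1)
    {s r k : ℕ} (hr : r < m s) (hk : k ≤ M m s) :
    lpPow p (fejerKernel m (r * M m s + k)) ≤
      ((m s : ℝ≥0∞) ^ (1 + p) + (m s : ℝ≥0∞) ^ p) * (M m s : ℝ≥0∞) ^ (2 * p - 1) +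
        (m s : ℝ≥0∞) ^ p * lpPow p (fejerKernel m (M m s)) + lpPow p (fejerKernel m k) := by
  have hF : lpPow p (fejerKernel m (r * M m s)) ≤
      (m s : ℝ≥0∞) ^ (1 + p) * (M m s : ℝ≥0∞) ^ (2 * p - 1) +
        (m s : ℝ≥0∞) ^ p * lpPow p (fejerKernel m (M m s)) :=
    (lpPow_fejerKernel_mul_M_le hm hp0 hp1 hr.le).trans (add_le_add_right
      (lpPow_mul_le hp0.le (by simp) (enorm_sum_rademacher_pow_le s hr.le) _) _)
  have hD : lpPow p (fun x => k * dirichletKernel m (r * M m s) x) ≤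
      (m s : ℝ≥0∞) ^ p * (M m s : ℝ≥0∞) ^ (2 * p - 1) := by
    calc _ ≤ (M m s : ℝ≥0∞) ^ p * ((m s : ℝ≥0∞) ^ p * (M m s : ℝ≥0∞) ^ (p - 1)) := by
          rw [lpPow_const_mul hp0.le]
          gcongr
          · simpa [← ofReal_norm] using hk
          · exact lpPow_dirichletKernel_mul_M_le hm hp0 hr.le
      _ = _ := by
          rw [mul_left_comm, M_rpow_mul_M_rpow]
          ring_nf
  rw [funext (fejerKernel_mul_M_add hm hr hk)]
  calc _ ≤ lpPow p (fejerKernel m (r * M m s)) +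
        lpPow p (fun x => k * dirichletKernel m (r * M m s) x) + lpPow p (fejerKernel m k) := by
        refine (lpPow_add_le hp0.le hp1 (by fun_prop) _).trans ?_
        rw [lpPow_rademacher_pow_mul]
        gcongr
        exact lpPow_add_le hp0.le hp1 (by fun_prop) _
    _ ≤ _ := by
        refine add_le_add_left ((add_le_add hF hD).trans_eq ?_) _
        ring

theorem exists_lpPow_fejerKernel_le (hm : ∀ k, 2 ≤ m k) (hbdd : ∃ C : ℕ, ∀ k, m k ≤ C)
    (hp0 : 0 < p) (hp1 : p ≤ 1) :
    ∃ B : ℝ≥0∞, B ≠ ∞ ∧ ∀ N, ∀ n < M m N, lpPow p (fejerKernel m n) ≤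
      B * ∑ s ∈ Finset.range N, (M m s : ℝ≥0∞) ^ (2 * p - 1) := by
  obtain ⟨A, hA, hFM⟩ := exists_lpPow_fejerKernel_M_le hm hbdd hp0 hp1
  obtain ⟨C, hC⟩ := hbdd
  have hCtop {a : ℝ} (ha : 0 ≤ a) : (C : ℝ≥0∞) ^ a ≠ ∞ :=
    ENNReal.rpow_ne_top_of_nonneg ha (by simp)
  refine ⟨(C : ℝ≥0∞) ^ (1 + p) + (C : ℝ≥0∞) ^ p + (C : ℝ≥0∞) ^ p * A,
    by have := hCtop hp0.le; have := hCtop (a := 1 + p) (by linarith); finiteness, fun N => ?_⟩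
  induction N with
  | zero =>
    intro n hn
    obtain rfl : n = 0 := by simpa [M] using hn
    simp [fejerKernel, lpPow, hp0]
  | succ N ih =>
    intro n hn
    have hr : n / M m N < m N := (Nat.div_lt_iff_lt_mul (M_pos N)).2 hn
    have hk : n % M m N < M m N := Nat.mod_lt _ (M_pos N)
    have hmC : (m N : ℝ≥0∞) ≤ C := by exact_mod_cast hC N
    rw [← Nat.div_add_mod' n (M m N), Finset.sum_range_succ, mul_add, add_comm (_ * ∑ _ ∈ _, _)]
    refine (lpPow_fejerKernel_mul_M_add_le hm hp0 hp1 hr hk.le).trans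
      (add_le_add ?_ (ih _ hk))
    rw [add_mul _ (_ * A), mul_assoc _ A]
    gcongr
    exact hFM N

end KernelEstimates

section FejerMeans

theorem rpow_lintegral_le {α : Type*} [MeasurableSpace α] {μ : Measure α} {p : ℝ} (hp0 : 0 < p)
    (hp1 : p ≤ 1) {h : α → ℝ≥0∞} (hfin : ∫⁻ y, h y ∂μ ≠ ∞) {C : ℝ≥0∞} (hC : C ≠ ∞)
    (hle : ∀ x, h x ≤ C * ∫⁻ y, h y ∂μ) :
    (∫⁻ x, h x ∂μ) ^ p ≤ C ^ (1 - p) * ∫⁻ x, h x ^ p ∂μ := by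
  set I := ∫⁻ y, h y ∂μ
  have hq : 0 ≤ 1 - p := sub_nonneg.2 hp1
  rcases eq_or_ne I 0 with h0 | h0
  · simp [h0, hp0]
  have hI0 : I ^ (1 - p) ≠ 0 := by simp [ENNReal.rpow_eq_zero_iff, h0, hfin]
  have hItop : I ^ (1 - p) ≠ ∞ := ENNReal.rpow_ne_top_of_nonneg hq hfin
  rw [← ENNReal.mul_le_mul_iff_right hI0 hItop]
  calc I ^ (1 - p) * I ^ p = ∫⁻ x, h x ∂μ := by
        rw [← ENNReal.rpow_add _ _ h0 hfin, sub_add_cancel, ENNReal.rpow_one]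
    _ ≤ ∫⁻ x, (C * I) ^ (1 - p) * h x ^ p ∂μ := by
        refine lintegral_mono fun x => ?_
        calc h x = h x ^ (1 - p) * h x ^ p := by
              rw [← ENNReal.rpow_add_of_nonneg _ _ hq hp0.le, sub_add_cancel, ENNReal.rpow_one]
          _ ≤ _ := by gcongr; exact hle x
    _ = I ^ (1 - p) * (C ^ (1 - p) * ∫⁻ x, h x ^ p ∂μ) := by
        rw [lintegral_const_mul' _ _ (ENNReal.rpow_ne_top_of_nonneg hq (by finiteness)),
          ENNReal.mul_rpow_of_nonneg _ _ hq]
        ring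

variable {m : ℕ → ℕ} [∀ k, NeZero (m k)]

theorem le_M_mul_lintegral {N : ℕ} {h : G m → ℝ≥0∞} (hh : DependsOn h (Set.Iio N)) (x : G m) :
    h x ≤ M m N * ∫⁻ y, h y ∂haar m := by
  have hcyl : ∫⁻ y in cyl m N x, h y ∂haar m = h x * (M m N : ℝ≥0∞)⁻¹ := by
    rw [setLIntegral_congr_fun (measurableSet_cyl m N x) (g := fun _ => h x) fun y hy => hh hy,
      setLIntegral_const, haar_cyl]
  calc h x = M m N * (h x * (M m N : ℝ≥0∞)⁻¹) := by
        rw [mul_left_comm, ENNReal.mul_inv_cancel (NeZero.ne _) (by simp), mul_one]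
    _ ≤ _ := by rw [← hcyl]; gcongr; exact Measure.restrict_le_self

variable {p : ℝ}

theorem rpow_lintegral_enorm_le_lpPow (hp0 : 0 < p) (hp1 : p ≤ 1) {N : ℕ} {g : G m → ℂ}
    (hg : DependsOn g (Set.Iio N)) :
    (∫⁻ x, ‖g x‖ₑ ∂haar m) ^ p ≤ (M m N : ℝ≥0∞) ^ (1 - p) * lpPow p g :=
  rpow_lintegral_le hp0 hp1 (integrable_of_dependsOn hg).2.ne (by simp)
    (le_M_mul_lintegral fun x y hxy => by rw [hg hxy])

theorem lpPow_convolution_le (hp0 : 0 < p) (hp1 : p ≤ 1) {N : ℕ} {g K : G m → ℂ}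
    (hg : DependsOn g (Set.Iio N)) (hK : DependsOn K (Set.Iio N)) :
    lpPow p (fun x => ∫ t, g t * K (x - t) ∂haar m) ≤
      (M m N : ℝ≥0∞) ^ (1 - p) * (lpPow p g * lpPow p K) := by
  have hgm := measurable_of_dependsOn (Set.finite_Iio N) hg
  have hKm := measurable_of_dependsOn (Set.finite_Iio N) hK
  have hM : (M m N : ℝ≥0∞) ^ (1 - p) ≠ ∞ :=
    ENNReal.rpow_ne_top_of_nonneg (sub_nonneg.2 hp1) (by simp)
  have hdep (x : G m) : DependsOn (fun t => g t * K (x - t)) (Set.Iio N) := fun t u htu =>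
    congrArg₂ _ (hg htu) (hK fun k hk => congrArg (x k - ·) (htu k hk))
  have htrans (t : G m) : ∫⁻ x, ‖K (x - t)‖ₑ ^ p ∂haar m = lpPow p K :=
    lintegral_sub_right_eq_self (fun x => ‖K x‖ₑ ^ p) t
  calc _ ≤ ∫⁻ x, (M m N : ℝ≥0∞) ^ (1 - p) *
        ∫⁻ t, ‖g t‖ₑ ^ p * ‖K (x - t)‖ₑ ^ p ∂haar m ∂haar m := by
        refine lintegral_mono fun x => ?_
        simp only [← ENNReal.mul_rpow_of_nonneg _ _ hp0.le, ← enorm_mul]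
        exact (ENNReal.rpow_le_rpow (enorm_integral_le_lintegral_enorm _) hp0.le).trans
          (rpow_lintegral_enorm_le_lpPow hp0 hp1 (hdep x))
    _ = (M m N : ℝ≥0∞) ^ (1 - p) *
        ∫⁻ t, ‖g t‖ₑ ^ p * ∫⁻ x, ‖K (x - t)‖ₑ ^ p ∂haar m ∂haar m := by
        rw [lintegral_const_mul' _ _ hM, lintegral_lintegral_swap (by fun_prop)]
        congr! 3 with t
        exact lintegral_const_mul' _ _ (ENNReal.rpow_ne_top_of_nonneg hp0.le enorm_ne_top)
    _ = _ := by
        simp only [htrans]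
        rw [lintegral_mul_const _ (by fun_prop), lpPow, lpPow]

theorem lpPow_fejer_coeff_le (hm : ∀ k, 2 ≤ m k) (hp0 : 0 < p) (hp1 : p ≤ 1) {N n : ℕ}
    (hn : n ≤ M m N) {g : G m → ℂ} (hg : DependsOn g (Set.Iio N)) :
    lpPow (m := m) p (fejer (coeff g) n) ≤ ((n : ℝ≥0∞)⁻¹ ^ p * (M m N : ℝ≥0∞) ^ (1 - p) *
      lpPow p (fejerKernel m n)) * lpPow p g := by
  rcases n.eq_zero_or_pos with rfl | hpos
  · rw [show fejer (coeff g) 0 = (0 : G m → ℂ) by funext x; simp [fejer], lpPow_zero hp0]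
    exact zero_le
  have hn0 : (n : ℂ) ≠ 0 := by exact_mod_cast hpos.ne'
  rw [funext (fejer_coeff_eq_integral (integrable_of_dependsOn hg) n), lpPow_const_mul hp0.le,
    enorm_inv hn0]
  calc _ ≤ ‖(n : ℂ)‖ₑ⁻¹ ^ p * ((M m N : ℝ≥0∞) ^ (1 - p) *
        (lpPow p g * lpPow p (fejerKernel m n))) := by
        gcongr
        exact lpPow_convolution_le hp0 hp1 hg (dependsOn_fejerKernel hm hn)
    _ = _ := by
        rw [show ‖(n : ℂ)‖ₑ = n by simp [← ofReal_norm]]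
        ring

theorem exists_lpPow_fejer_M_sub_self_le (hm : ∀ k, 2 ≤ m k) (hbdd : ∃ C : ℕ, ∀ k, m k ≤ C)
    (hp0 : 0 < p) (hp1 : p ≤ 1) :
    ∃ B : ℝ≥0∞, B ≠ ∞ ∧ ∀ N, ∀ g : G m → ℂ, DependsOn g (Set.Iio N) →
      lpPow p (fun x => fejer (coeff g) (M m N) x - g x) ≤ B * lpPow p g := by
  obtain ⟨B, hB, hF⟩ := exists_lpPow_fejerKernel_M_le hm hbdd hp0 hp1
  refine ⟨B + 1, by finiteness, fun N g hg => ?_⟩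
  refine (lpPow_sub_le hp0.le hp1 (by fun_prop) g).trans ?_
  rw [add_mul, one_mul]
  refine add_le_add_left ((lpPow_fejer_coeff_le hm hp0 hp1 le_rfl hg).trans ?_) _
  gcongr ?_ * _
  calc _ ≤ (M m N : ℝ≥0∞)⁻¹ ^ p * (M m N : ℝ≥0∞) ^ (1 - p) *
        (B * (M m N : ℝ≥0∞) ^ (2 * p - 1)) := by gcongr; exact hF N
    _ = B * ((M m N : ℝ≥0∞) ^ (-p) * (M m N : ℝ≥0∞) ^ (1 - p) *
        (M m N : ℝ≥0∞) ^ (2 * p - 1)) := by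
        rw [ENNReal.inv_rpow, ← ENNReal.rpow_neg]
        ring
    _ = B := by
        rw [M_rpow_mul_M_rpow, M_rpow_mul_M_rpow, show -p + (1 - p) + (2 * p - 1) = 0 by ring,
          ENNReal.rpow_zero, mul_one]

/-- The growth rate `∑_{s ≤ N} (M_N / M_s)^{1-2p}` of the operators `σ_n`, `M_N ≤ n < M_{N+1}`, in
the `p`-th power of the `L_p` norm. -/
noncomputable def fejerWeight (m : ℕ → ℕ) (p : ℝ) (N : ℕ) : ℝ≥0∞ :=
  ∑ s ∈ Finset.range (N + 1), ((M m N : ℝ≥0∞) / M m s) ^ (1 - 2 * p)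

theorem fejerWeight_eq_mul_sum (p : ℝ) (N : ℕ) :
    fejerWeight m p N = (M m N : ℝ≥0∞) ^ (1 - 2 * p) *
      ∑ s ∈ Finset.range (N + 1), (M m s : ℝ≥0∞) ^ (2 * p - 1) := by
  rw [fejerWeight, Finset.mul_sum]
  refine Finset.sum_congr rfl fun s _ => ?_
  rw [div_eq_mul_inv, ENNReal.mul_rpow_of_ne_top (by simp) (by simp [(M_pos s).ne']),
    ENNReal.inv_rpow, ← ENNReal.rpow_neg, neg_sub]

theorem one_le_fejerWeight (p : ℝ) (N : ℕ) : 1 ≤ fejerWeight m p N := by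
  calc (1 : ℝ≥0∞) = ((M m N : ℝ≥0∞) / M m N) ^ (1 - 2 * p) := by
        rw [ENNReal.div_self (NeZero.ne _) (by simp), ENNReal.one_rpow]
    _ ≤ _ := Finset.single_le_sum (f := fun s => ((M m N : ℝ≥0∞) / M m s) ^ (1 - 2 * p))
        (fun _ _ => zero_le) (Finset.self_mem_range_succ N)

theorem exists_lpPow_fejer_le (hm : ∀ k, 2 ≤ m k) (hbdd : ∃ C : ℕ, ∀ k, m k ≤ C)
    (hp0 : 0 < p) (hp1 : p ≤ 1) :
    ∃ B : ℝ≥0∞, B ≠ ∞ ∧ ∀ N n, M m N ≤ n → n < M m (N + 1) → ∀ g : G m → ℂ,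
      DependsOn g (Set.Iio (N + 1)) →
        lpPow (m := m) p (fejer (coeff g) n) ≤ B * fejerWeight m p N * lpPow p g := by
  obtain ⟨B, hB, hF⟩ := exists_lpPow_fejerKernel_le hm hbdd hp0 hp1
  obtain ⟨C, hC⟩ := hbdd
  have hq : 0 ≤ 1 - p := sub_nonneg.2 hp1
  refine ⟨(C : ℝ≥0∞) ^ (1 - p) * B,
    ENNReal.mul_ne_top (ENNReal.rpow_ne_top_of_nonneg hq (by simp)) hB,
    fun N n hn1 hn2 g hg => (lpPow_fejer_coeff_le hm hp0 hp1 hn2.le hg).trans ?_⟩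
  gcongr ?_ * _
  calc _ ≤ (M m N : ℝ≥0∞)⁻¹ ^ p * ((C : ℝ≥0∞) ^ (1 - p) * (M m N : ℝ≥0∞) ^ (1 - p)) *
        (B * ∑ s ∈ Finset.range (N + 1), (M m s : ℝ≥0∞) ^ (2 * p - 1)) := by
        rw [M_succ_rpow]
        gcongr
        · exact_mod_cast hC N
        · exact hF _ _ hn2
    _ = _ := by
        rw [fejerWeight_eq_mul_sum, show 1 - 2 * p = -p + (1 - p) by ring, ← M_rpow_mul_M_rpow,
          ENNReal.inv_rpow, ← ENNReal.rpow_neg]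
        ring

end FejerMeans

section MaximalFunction

variable {m : ℕ → ℕ} {f : ℕ → G m → ℂ}

/-- The martingale `f - f^{(N)}`, where `f^{(N)}` stands for `f` stopped at time `N`; it equals the
martingale `f - S_{M_N} f` in the definition of `modulus`. -/
def tail (f : ℕ → G m → ℂ) (N k : ℕ) (x : G m) : ℂ := f k x - f (min k N) x

theorem tail_min_succ (f : ℕ → G m → ℂ) (N k : ℕ) :
    tail f N (min k (N + 1)) = fun x => f (min k (N + 1)) x - f (min k N) x := by
  funext x
  rw [tail, min_assoc, min_eq_right N.le_succ]

theorem maximal_tail_le (f : ℕ → G m → ℂ) (N : ℕ) (x : G m) :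
    maximal (tail f N) x ≤ maximal f x + maximal f x :=
  iSup_le fun k => enorm_sub_le.trans
    (add_le_add (le_iSup (fun k => ‖f k x‖ₑ) k) (le_iSup (fun k => ‖f k x‖ₑ) _))

theorem enorm_sub_le_maximal_tail {k N : ℕ} (hk : N ≤ k) (x : G m) :
    ‖f k x - f N x‖ₑ ≤ maximal (tail f N) x := by
  rw [show f k x - f N x = tail f N k x by rw [tail, min_eq_right hk]]
  exact le_iSup (fun k => ‖tail f N k x‖ₑ) k

variable [∀ k, NeZero (m k)] {p : ℝ}

theorem hpNorm_rpow (hp0 : 0 < p) (f : ℕ → G m → ℂ) :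
    hpNorm p f ^ p = ∫⁻ x, maximal f x ^ p ∂haar m := by
  rw [hpNorm, ← ENNReal.rpow_mul, one_div_mul_cancel hp0.ne', ENNReal.rpow_one]

theorem lpPow_le_hpNorm_rpow (hp0 : 0 < p) (f : ℕ → G m → ℂ) (k : ℕ) :
    lpPow p (f k) ≤ hpNorm p f ^ p := by
  rw [hpNorm_rpow hp0]
  exact lintegral_mono fun x => ENNReal.rpow_le_rpow (le_iSup (fun k => ‖f k x‖ₑ) k) hp0.le

theorem lpPow_le_iSup_of_ae_tendsto (hf : ∀ k, Measurable (f k)) {g : G m → ℂ}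
    (hlim : ∀ᵐ x ∂haar m, Tendsto (fun k => f k x) atTop (𝓝 (g x))) :
    lpPow p g ≤ ⨆ k, lpPow p (f k) := by
  calc lpPow p g = ∫⁻ x, liminf (fun k => ‖f k x‖ₑ ^ p) atTop ∂haar m := by
        refine lintegral_congr_ae ?_
        filter_upwards [hlim] with x hx
        exact ((ENNReal.continuous_rpow_const.tendsto _).comp hx.enorm).liminf_eq.symm
    _ ≤ liminf (fun k => lpPow p (f k)) atTop :=
        lintegral_liminf_le fun k => by have := hf k; fun_prop
    _ ≤ ⨆ k, lpPow p (f k) := liminf_le_of_le (by isBoundedDefault) fun b hb => by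
        obtain ⟨k, hk⟩ := hb.exists
        exact hk.trans (le_iSup (fun k => lpPow p (f k)) k)

end MaximalFunction

section Martingales

variable {m : ℕ → ℕ} [∀ k, NeZero (m k)] {p : ℝ} {f : ℕ → G m → ℂ}

theorem dependsOn_of_measurable_filt {β : Type*} [MeasurableSpace β] [MeasurableSingletonClass β]
    {k : ℕ} {g : G m → β} (hg : Measurable[filt m k] g) : DependsOn g (Set.Iio k) := by
  intro x y hxy
  have key : ∀ s, MeasurableSet[filt m k] s → (x ∈ s ↔ y ∈ s) := by
    refine MeasurableSpace.forall_generateFrom_mem_iff_mem_iff.2 ?_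
    rintro _ ⟨z, rfl⟩
    exact forall₂_congr fun j hj => by rw [hxy j hj]
  exact ((key _ (hg (MeasurableSet.singleton (g x)))).1 rfl).symm

theorem dependsOn_martingale (hf : Martingale f (filt m) (haar m)) {k N : ℕ} (hk : k ≤ N) :
    DependsOn (f k) (Set.Iio N) :=
  (dependsOn_of_measurable_filt (hf.stronglyMeasurable k).measurable).mono (Set.Iio_subset_Iio hk)

theorem measurable_martingale (hf : Martingale f (filt m) (haar m)) (k : ℕ) : Measurable (f k) :=
  measurable_of_dependsOn (Set.finite_Iio k) (dependsOn_martingale hf le_rfl)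

theorem measurable_tail (hf : Martingale f (filt m) (haar m)) (N k : ℕ) :
    Measurable (tail f N k) :=
  (measurable_martingale hf k).sub (measurable_martingale hf _)

theorem dependsOn_tail_min (hf : Martingale f (filt m) (haar m)) (N k : ℕ) :
    DependsOn (tail f N (min k (N + 1))) (Set.Iio (N + 1)) := fun x y hxy => by
  simp only [tail_min_succ, dependsOn_martingale hf (min_le_right k (N + 1)) hxy,
    dependsOn_martingale hf ((min_le_right k N).trans N.le_succ) hxy]

theorem partialSum_M_martingale (hm : ∀ k, 2 ≤ m k) (hf : Martingale f (filt m) (haar m))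
    (k N : ℕ) : partialSum (coeff (f k)) (M m N) = f (min k N) := by
  rcases le_total k N with h | h
  · rw [min_eq_left h, partialSum_M_eq_self hm (dependsOn_martingale hf h)]
  · have hcyl (x : G m) : MeasurableSet[filt m N] (cyl m N x) :=
      MeasurableSpace.measurableSet_generateFrom ⟨x, rfl⟩
    rw [min_eq_right h, ← partialSum_M_eq_self hm (dependsOn_martingale hf (le_refl N))]
    funext x
    rw [partialSum_M_eq_setIntegral hm (hf.integrable k),
      partialSum_M_eq_setIntegral hm (hf.integrable N), hf.setIntegral_eq h (hcyl x)]

theorem coeff_martingale_eq_min (hm : ∀ k, 2 ≤ m k) (hf : Martingale f (filt m) (haar m))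
    {N i : ℕ} (hi : i < M m N) (k : ℕ) : coeff (f k) i = coeff (f (min k N)) i := by
  rw [← partialSum_M_martingale hm hf, coeff_partialSum hm, if_pos hi]

theorem martCoeff_eq (hm : ∀ k, 2 ≤ m k) (hf : Martingale f (filt m) (haar m))
    {N i : ℕ} (hi : i < M m N) {k : ℕ} (hk : N ≤ k) : martCoeff f i = coeff (f k) i := by
  refine Tendsto.limUnder_eq (tendsto_const_nhds.congr' ?_)
  filter_upwards [eventually_ge_atTop N] with j hj
  rw [coeff_martingale_eq_min hm hf hi, coeff_martingale_eq_min hm hf hi j, min_eq_right hk,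
    min_eq_right hj]

theorem modulus_eq (hm : ∀ k, 2 ≤ m k) (hf : Martingale f (filt m) (haar m)) (p : ℝ) (N : ℕ) :
    modulus p f N = hpNorm p (tail f N) := by
  simp only [modulus, partialSum_M_martingale hm hf]
  rfl

theorem lpPow_tail_le (hm : ∀ k, 2 ≤ m k) (hf : Martingale f (filt m) (haar m)) (hp0 : 0 < p)
    (N k : ℕ) : lpPow p (tail f N k) ≤ modulus p f N ^ p := by
  rw [modulus_eq hm hf]
  exact lpPow_le_hpNorm_rpow hp0 _ k

theorem modulus_ne_top (hm : ∀ k, 2 ≤ m k) (hp0 : 0 < p) (hp1 : p ≤ 1) (hf : MemHp p f) (N : ℕ) :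
    modulus p f N ≠ ∞ := by
  have hmeas : Measurable fun x => maximal f x ^ p :=
    (Measurable.iSup fun k => (measurable_martingale hf.1 k).enorm).pow_const p
  have hfin : hpNorm p f ^ p ≠ ∞ := ENNReal.rpow_ne_top_of_nonneg hp0.le hf.2.ne
  have hle : modulus p f N ^ p ≤ hpNorm p f ^ p + hpNorm p f ^ p := by
    rw [modulus_eq hm hf.1, hpNorm_rpow hp0, hpNorm_rpow hp0, ← lintegral_add_left hmeas]
    exact lintegral_mono fun x => (ENNReal.rpow_le_rpow (maximal_tail_le f N x) hp0.le).trans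
      (ENNReal.rpow_add_le_add_rpow _ _ hp0.le hp1)
  exact ((ENNReal.rpow_lt_top_iff_of_pos hp0).1
    (hle.trans_lt (ENNReal.add_lt_top.2 ⟨hfin.lt_top, hfin.lt_top⟩))).ne

-- `∫ ⨅_N sup_k |f^{(k)} - f^{(min k N)}|^p = 0`, so almost every `(f^{(k)} x)_k` is Cauchy.
theorem ae_exists_tendsto_martingale (hm : ∀ k, 2 ≤ m k) (hf : Martingale f (filt m) (haar m))
    (hp0 : 0 < p) (hω : Tendsto (fun N => modulus p f N ^ p) atTop (𝓝 0)) :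
    ∀ᵐ x ∂haar m, ∃ l, Tendsto (fun k => f k x) atTop (𝓝 l) := by
  have hmeas : Measurable fun x => ⨅ N, maximal (tail f N) x ^ p :=
    .iInf fun N => (Measurable.iSup fun k => (measurable_tail hf N k).enorm).pow_const p
  have h0 : ∫⁻ x, ⨅ N, maximal (tail f N) x ^ p ∂haar m = 0 := by
    refine le_antisymm (ge_of_tendsto' hω fun N => ?_) zero_le
    rw [modulus_eq hm hf, hpNorm_rpow hp0]
    exact lintegral_mono fun x => iInf_le _ N
  filter_upwards [(lintegral_eq_zero_iff hmeas).1 h0] with x hx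
  refine cauchySeq_tendsto_of_complete (EMetric.cauchySeq_iff'.2 fun ε hε => ?_)
  have hlt : ⨅ N, maximal (tail f N) x ^ p < ε ^ p := by
    rw [show ⨅ N, maximal (tail f N) x ^ p = 0 from hx]
    exact ENNReal.rpow_pos_of_nonneg hε hp0.le
  obtain ⟨N, hN⟩ := iInf_lt_iff.1 hlt
  refine ⟨N, fun k hk => ?_⟩
  rw [edist_eq_enorm_sub]
  exact (enorm_sub_le_maximal_tail hk x).trans_lt ((ENNReal.rpow_lt_rpow_iff hp0).1 hN)

end Martingales

section Convergence

theorem tendsto_zero_of_le_mul_add {u δ : ℕ → ℝ≥0∞} {q B : ℝ≥0∞} (hq : q < 1) (hB : B ≠ ∞)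
    (hu : ∀ n, u n ≤ B) (hrec : ∀ n, u (n + 1) ≤ q * u n + δ n) (hδ : Tendsto δ atTop (𝓝 0)) :
    Tendsto u atTop (𝓝 0) := by
  set L := limsup u atTop
  have hLtop : L ≠ ∞ := ((limsup_le_of_le (by isBoundedDefault) (.of_forall hu)).trans_lt
    hB.lt_top).ne
  have hL : L ≤ q * L := by
    calc L = limsup (fun n => u (n + 1)) atTop := (limsup_nat_add u 1).symm
      _ ≤ limsup ((fun n => q * u n) + δ) atTop := limsup_le_limsup (.of_forall hrec)
      _ = q * L := by
          rw [ENNReal.limsup_add_of_right_tendsto_zero hδ,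
            ENNReal.limsup_const_mul_of_ne_top hq.ne_top]
  have hL0 : L = 0 := by
    by_contra h0
    exact hL.not_gt (by simpa using ENNReal.mul_lt_mul_left h0 hLtop hq)
  exact tendsto_of_le_liminf_of_limsup_le zero_le hL0.le

theorem tendsto_zero_of_le_of_M_le {m : ℕ → ℕ} [∀ k, NeZero (m k)] (hm : ∀ k, 2 ≤ m k)
    {u E : ℕ → ℝ≥0∞} (hE : Tendsto E atTop (𝓝 0))
    (hu : ∀ N n, M m N ≤ n → n < M m (N + 1) → u n ≤ E N) : Tendsto u atTop (𝓝 0) := by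
  refine ENNReal.tendsto_nhds_zero.2 fun ε hε => ?_
  obtain ⟨K, hK⟩ := eventually_atTop.1 (ENNReal.tendsto_nhds_zero.1 hE ε hε)
  filter_upwards [eventually_ge_atTop (M m K)] with n hn
  have hfind := exists_lt_M hm n
  obtain ⟨N, hN⟩ : ∃ N, Nat.find hfind = K + N + 1 :=
    Nat.exists_eq_add_of_lt <| (Nat.lt_find_iff hfind K).2 fun j hj =>
      (((M_mono hj).trans hn).not_gt)
  have hle : M m (K + N) ≤ n := not_lt.1 (Nat.find_min hfind (by omega))
  exact (hu _ n hle (hN ▸ Nat.find_spec hfind)).trans (hK _ (by omega))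

theorem tendsto_rpow_zero {α : Type*} {l : Filter α} {u : α → ℝ≥0∞} (hu : Tendsto u l (𝓝 0))
    {q : ℝ} (hq : 0 < q) : Tendsto (fun a => u a ^ q) l (𝓝 0) := by
  simpa only [ENNReal.zero_rpow_of_pos hq, Function.comp_def] using
    (ENNReal.continuous_rpow_const (y := q)).tendsto 0 |>.comp hu

variable {m : ℕ → ℕ} [∀ k, NeZero (m k)] {p : ℝ} {f : ℕ → G m → ℂ}

theorem lpPow_fejer_coeff_sub_self (hm : ∀ k, 2 ≤ m k) (hp0 : 0 ≤ p) {N : ℕ} {g : G m → ℂ}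
    (hg : DependsOn g (Set.Iio N)) {n : ℕ} (hn : M m N ≤ n) :
    lpPow p (fun x => fejer (coeff g) n x - g x) =
      ((M m N : ℝ≥0∞) / n) ^ p * lpPow p fun x => fejer (coeff g) (M m N) x - g x := by
  have hn0 : (n : ℂ) ≠ 0 := by exact_mod_cast ((M_pos N).trans_le hn).ne'
  have hnorm : ‖(M m N / n : ℂ)‖ₑ = (M m N : ℝ≥0∞) / n := by
    rw [div_eq_mul_inv, enorm_mul, enorm_inv hn0, ← div_eq_mul_inv]
    simp [← ofReal_norm]
  rw [funext (fejer_coeff_sub_self hm hg hn), lpPow_const_mul hp0, hnorm]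

/-- The largest `‖σ_{M_N} f^{(k)} - f^{(k)}‖_p^p`, `k ≤ N`. It dominates the same quantity for all
`M_N ≤ n < M_{N+1}` and contracts from `N` to `N + 1`, up to the modulus of continuity. -/
noncomputable def fejerError (p : ℝ) (f : ℕ → G m → ℂ) (N : ℕ) : ℝ≥0∞ :=
  ⨆ k, lpPow p fun x => fejer (coeff (f (min k N))) (M m N) x - f (min k N) x

theorem lpPow_fejer_martingale_min_sub_le (hm : ∀ k, 2 ≤ m k)
    (hf : Martingale f (filt m) (haar m)) (hp0 : 0 ≤ p) {N n : ℕ} (hn : M m N ≤ n) (k : ℕ) :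
    lpPow p (fun x => fejer (coeff (f (min k N))) n x - f (min k N) x) ≤
      ((M m N : ℝ≥0∞) / n) ^ p * fejerError p f N := by
  rw [lpPow_fejer_coeff_sub_self hm hp0 (dependsOn_martingale hf (min_le_right k N)) hn]
  gcongr
  exact le_iSup (fun k => lpPow p fun x => fejer (coeff (f (min k N))) (M m N) x - f (min k N) x) k

theorem fejer_martingale_min_succ (hf : Martingale f (filt m) (haar m)) (N k n : ℕ) (x : G m) :
    fejer (coeff (f (min k (N + 1)))) n x =
      fejer (coeff (f (min k N))) n x + fejer (coeff (tail f N (min k (N + 1)))) n x := by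
  rw [tail_min_succ, fejer_coeff_sub (hf.integrable _) (hf.integrable _)]
  ring

theorem exists_fejerError_succ_le (hm : ∀ k, 2 ≤ m k) (hbdd : ∃ C : ℕ, ∀ k, m k ≤ C)
    (hp0 : 0 < p) (hp1 : p ≤ 1) (hf : Martingale f (filt m) (haar m)) :
    ∃ B : ℝ≥0∞, B ≠ ∞ ∧ ∀ N, fejerError p f (N + 1) ≤
      2 ^ (-p) * fejerError p f N + B * modulus p f N ^ p := by
  obtain ⟨B, hB, hbound⟩ := exists_lpPow_fejer_M_sub_self_le (m := m) hm hbdd hp0 hp1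
  refine ⟨B, hB, fun N => iSup_le fun k => ?_⟩
  have hratio : ((M m N : ℝ≥0∞) / M m (N + 1)) ^ p ≤ 2 ^ (-p) := by
    rw [ENNReal.rpow_neg, ← ENNReal.inv_rpow]
    gcongr
    rw [ENNReal.div_le_iff (NeZero.ne _) (by simp), ← ENNReal.div_eq_inv_mul,
      ENNReal.le_div_iff_mul_le (by simp) (by simp), mul_comm]
    exact_mod_cast Nat.mul_le_mul_right _ (hm N)
  have hsplit (x : G m) : fejer (coeff (f (min k (N + 1)))) (M m (N + 1)) x - f (min k (N + 1)) x =
      (fejer (coeff (f (min k N))) (M m (N + 1)) x - f (min k N) x) +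
        (fejer (coeff (tail f N (min k (N + 1)))) (M m (N + 1)) x -
          tail f N (min k (N + 1)) x) := by
    rw [fejer_martingale_min_succ hf, congrFun (tail_min_succ f N k) x]
    ring
  have hmeas := measurable_martingale hf (min k N)
  rw [funext hsplit]
  refine (lpPow_add_le hp0.le hp1 (by fun_prop) _).trans (add_le_add ?_ ?_)
  · refine (lpPow_fejer_martingale_min_sub_le hm hf hp0.le (M_mono N.le_succ) k).trans ?_
    gcongr
  · refine (hbound _ _ (dependsOn_tail_min hf N k)).trans ?_
    gcongr
    exact lpPow_tail_le hm hf hp0 N _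

theorem tendsto_fejerError (hm : ∀ k, 2 ≤ m k) (hbdd : ∃ C : ℕ, ∀ k, m k ≤ C)
    (hp0 : 0 < p) (hp1 : p ≤ 1) (hf : MemHp p f)
    (hω : Tendsto (fun N => modulus p f N ^ p) atTop (𝓝 0)) :
    Tendsto (fejerError p f) atTop (𝓝 0) := by
  obtain ⟨B, hB, hrec⟩ := exists_fejerError_succ_le hm hbdd hp0 hp1 hf.1
  obtain ⟨B', hB', hbound⟩ := exists_lpPow_fejer_M_sub_self_le (m := m) hm hbdd hp0 hp1
  have hfin : B' * hpNorm p f ^ p ≠ ∞ :=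
    ENNReal.mul_ne_top hB' (ENNReal.rpow_ne_top_of_nonneg hp0.le hf.2.ne)
  refine tendsto_zero_of_le_mul_add (two_rpow_neg_lt_one hp0) hfin (fun N => iSup_le fun k => ?_)
    hrec (by simpa using ENNReal.Tendsto.const_mul hω (.inr hB))
  refine (hbound N _ (dependsOn_martingale hf.1 (min_le_right k N))).trans ?_
  gcongr
  exact lpPow_le_hpNorm_rpow hp0 f _

theorem exists_lpPow_fejer_martingale_sub_le (hm : ∀ k, 2 ≤ m k) (hbdd : ∃ C : ℕ, ∀ k, m k ≤ C)
    (hp0 : 0 < p) (hp1 : p ≤ 1) (hf : Martingale f (filt m) (haar m)) :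
    ∃ B : ℝ≥0∞, B ≠ ∞ ∧ ∀ N n, M m N ≤ n → n < M m (N + 1) → ∀ k,
      lpPow p (fun x => fejer (coeff (f k)) n x - f k x) ≤
        fejerError p f N + B * (fejerWeight m p N * modulus p f N ^ p) := by
  obtain ⟨B, hB, hbound⟩ := exists_lpPow_fejer_le (m := m) hm hbdd hp0 hp1
  refine ⟨B + 1, by finiteness, fun N n hn1 hn2 k => ?_⟩
  have hsplit (x : G m) : fejer (coeff (f k)) n x - f k x =
      (fejer (coeff (f (min k N))) n x - f (min k N) x) +
        (fejer (coeff (tail f N (min k (N + 1)))) n x - tail f N k x) := by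
    rw [fejer_congr (fun i hi => coeff_martingale_eq_min hm hf (hi.trans hn2) k),
      fejer_martingale_min_succ hf, tail]
    ring
  have hmeas := measurable_martingale hf (min k N)
  rw [funext hsplit]
  refine (lpPow_add_le hp0.le hp1 (by fun_prop) _).trans (add_le_add ?_ ?_)
  · refine (lpPow_fejer_martingale_min_sub_le hm hf hp0.le hn1 k).trans
      (mul_le_of_le_one_left zero_le (ENNReal.rpow_le_one ?_ hp0.le))
    exact ENNReal.div_le_of_le_mul (by rw [one_mul]; exact_mod_cast hn1)
  · calc _ ≤ lpPow (m := m) p (fejer (coeff (tail f N (min k (N + 1)))) n) +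
          lpPow p (tail f N k) := lpPow_sub_le hp0.le hp1 (by fun_prop) _
      _ ≤ B * fejerWeight m p N * modulus p f N ^ p +
          fejerWeight m p N * modulus p f N ^ p := by
          gcongr
          · refine (hbound N n hn1 hn2 _ (dependsOn_tail_min hf N k)).trans ?_
            gcongr
            exact lpPow_tail_le hm hf hp0 N _
          · exact (lpPow_tail_le hm hf hp0 N k).trans
              (le_mul_of_one_le_left zero_le (one_le_fejerWeight p N))
      _ = _ := by ring

theorem tendsto_modulus_rpow
    (hω : Tendsto (fun N => fejerWeight m p N * modulus p f N ^ p) atTop (𝓝 0)) :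
    Tendsto (fun N => modulus p f N ^ p) atTop (𝓝 0) :=
  tendsto_of_tendsto_of_tendsto_of_le_of_le tendsto_const_nhds hω (fun _ => zero_le)
    fun N => le_mul_of_one_le_left zero_le (one_le_fejerWeight p N)

theorem tendsto_iSup_lpPow_fejer_martingale_sub (hm : ∀ k, 2 ≤ m k)
    (hbdd : ∃ C : ℕ, ∀ k, m k ≤ C) (hp0 : 0 < p) (hp1 : p ≤ 1) (hf : MemHp p f)
    (hω : Tendsto (fun N => fejerWeight m p N * modulus p f N ^ p) atTop (𝓝 0)) :
    Tendsto (fun n => ⨆ k, lpPow p fun x => fejer (coeff (f k)) n x - f k x) atTop (𝓝 0) := by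
  obtain ⟨B, hB, hbound⟩ := exists_lpPow_fejer_martingale_sub_le hm hbdd hp0 hp1 hf.1
  refine tendsto_zero_of_le_of_M_le hm ?_ fun N n hn1 hn2 => iSup_le (hbound N n hn1 hn2)
  simpa using (tendsto_fejerError hm hbdd hp0 hp1 hf (tendsto_modulus_rpow hω)).add
    (ENNReal.Tendsto.const_mul hω (.inr hB))

theorem lpPow_fejer_martCoeff_sub_le (hm : ∀ k, 2 ≤ m k) (hf : Martingale f (filt m) (haar m))
    {g : G m → ℂ} (hlim : ∀ᵐ x ∂haar m, Tendsto (fun k => f k x) atTop (𝓝 (g x))) (n : ℕ) :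
    lpPow p (fun x => fejer (martCoeff f) n x - g x) ≤
      ⨆ k, lpPow p fun x => fejer (coeff (f k)) n x - f k x := by
  have hmeas := measurable_martingale hf
  refine lpPow_le_iSup_of_ae_tendsto (fun k => by have := hmeas k; fun_prop) ?_
  obtain ⟨N, hN⟩ := exists_lt_M hm n
  filter_upwards [hlim] with x hx
  refine Tendsto.sub (tendsto_const_nhds.congr' ?_) hx
  filter_upwards [eventually_ge_atTop N] with k hk
  exact fejer_congr (fun i hi => martCoeff_eq hm hf (hi.trans hN) hk) x

end Convergence

section Growth

variable {m : ℕ → ℕ} [∀ k, NeZero (m k)] {p : ℝ}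

theorem exists_fejerWeight_le (hm : ∀ k, 2 ≤ m k) (hp0 : 0 < p) (hp : p ≤ 1 / 2) :
    ∃ B : ℝ≥0∞, B ≠ ∞ ∧ ∀ N : ℕ, 1 ≤ N → fejerWeight m p N ≤
      B * ((M m N : ℝ≥0∞) ^ (1 / p - 2) * (N : ℝ≥0∞) ^ (2 * ⌊1 / 2 + p⌋₊)) ^ p := by
  rcases hp.lt_or_eq with hlt | rfl
  · have hfloor : ⌊1 / 2 + p⌋₊ = 0 := Nat.floor_eq_zero.2 (by linarith)
    set q : ℝ≥0∞ := 2 ^ (-(1 - 2 * p)) with hq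
    have hq1 : q < 1 := two_rpow_neg_lt_one (by linarith)
    have hterm (s : ℕ) : (M m s : ℝ≥0∞) ^ (2 * p - 1) ≤ q ^ s := by
      rw [hq, ← ENNReal.rpow_mul_natCast, mul_comm _ (s : ℝ), ENNReal.rpow_natCast_mul,
        ← neg_sub, ENNReal.rpow_neg, ENNReal.rpow_neg]
      gcongr
      · linarith
      · exact_mod_cast two_pow_le_M hm s
    refine ⟨(1 - q)⁻¹, by simpa using (tsub_pos_of_lt hq1).ne', fun N _ => ?_⟩
    calc fejerWeight m p N ≤ (M m N : ℝ≥0∞) ^ (1 - 2 * p) * (1 - q)⁻¹ := by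
          rw [fejerWeight_eq_mul_sum, ← ENNReal.tsum_geometric]
          gcongr
          exact (Finset.sum_le_sum fun s _ => hterm s).trans (ENNReal.sum_le_tsum _)
      _ = _ := by
          rw [hfloor, mul_zero, pow_zero, mul_one, ← ENNReal.rpow_mul, mul_comm,
            show (1 / p - 2) * p = 1 - 2 * p by field_simp]
  · have hfloor : ⌊(1 / 2 + 1 / 2 : ℝ)⌋₊ = 1 := by norm_num
    refine ⟨2, by simp, fun N hN => ?_⟩
    calc fejerWeight m (1 / 2) N = N + 1 := by simp [fejerWeight]
      _ ≤ 2 * N := by exact_mod_cast (by omega : N + 1 ≤ 2 * N)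
      _ = _ := by
          rw [hfloor, ← ENNReal.rpow_natCast, ENNReal.mul_rpow_of_nonneg _ _ (by norm_num),
            ← ENNReal.rpow_mul, ← ENNReal.rpow_mul]
          norm_num

theorem tendsto_fejerWeight_mul_modulus (hm : ∀ k, 2 ≤ m k) (hp0 : 0 < p) (hp : p ≤ 1 / 2)
    {f : ℕ → G m → ℂ} (hf : MemHp p f)
    (hω : (fun N : ℕ => (modulus p f N).toReal) =o[atTop]
      fun N : ℕ => 1 / ((M m N : ℝ) ^ (1 / p - 2) * (N : ℝ) ^ (2 * ⌊1 / 2 + p⌋₊))) :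
    Tendsto (fun N => fejerWeight m p N * modulus p f N ^ p) atTop (𝓝 0) := by
  obtain ⟨B, hB, hweight⟩ := exists_fejerWeight_le hm hp0 hp
  have hlim : Tendsto (fun N : ℕ => (M m N : ℝ≥0∞) ^ (1 / p - 2) *
      (N : ℝ≥0∞) ^ (2 * ⌊1 / 2 + p⌋₊) * modulus p f N) atTop (𝓝 0) := by
    have hreal := ENNReal.tendsto_ofReal hω.tendsto_div_nhds_zero
    rw [ENNReal.ofReal_zero] at hreal
    refine hreal.congr fun N => ?_
    have hM : (0 : ℝ) < M m N := by exact_mod_cast M_pos N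
    rw [div_div_eq_mul_div, div_one, mul_comm, ENNReal.ofReal_mul (by positivity),
      ENNReal.ofReal_mul (by positivity), ENNReal.ofReal_pow N.cast_nonneg,
      ← ENNReal.ofReal_rpow_of_pos hM, ENNReal.ofReal_natCast, ENNReal.ofReal_natCast,
      ENNReal.ofReal_toReal (modulus_ne_top hm hp0 (by linarith) hf N)]
  have hlimB : Tendsto (fun N : ℕ => B * ((M m N : ℝ≥0∞) ^ (1 / p - 2) *
      (N : ℝ≥0∞) ^ (2 * ⌊1 / 2 + p⌋₊) * modulus p f N) ^ p) atTop (𝓝 0) := by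
    simpa using ENNReal.Tendsto.const_mul (tendsto_rpow_zero hlim hp0) (.inr hB)
  refine tendsto_of_tendsto_of_tendsto_of_le_of_le' tendsto_const_nhds hlimB
    (.of_forall fun _ => zero_le) ?_
  filter_upwards [eventually_ge_atTop 1] with N hN
  rw [ENNReal.mul_rpow_of_nonneg _ _ hp0.le, ← mul_assoc]
  gcongr
  exact hweight N hN

end Growth

end Vilenkin

theorem theorem1_general (m : ℕ → ℕ) [∀ k, NeZero (m k)] (hm : ∀ k, 2 ≤ m k)
    (hbdd : ∃ C : ℕ, ∀ k, m k ≤ C) (p : ℝ) (hp0 : 0 < p) (hp1 : p ≤ 1)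
    (f : ℕ → Vilenkin.G m → ℂ) (hf : Vilenkin.MemHp p f)
    (hω : Tendsto (fun N => Vilenkin.fejerWeight m p N * Vilenkin.modulus p f N ^ p)
      atTop (𝓝 0)) :
    (∃ g : Vilenkin.G m → ℂ, Measurable g ∧ Vilenkin.lpNorm p g < ∞ ∧
      (∀ᵐ x ∂Vilenkin.haar m, Tendsto (fun k => f k x) atTop (𝓝 (g x))) ∧
      Tendsto (fun n : ℕ => Vilenkin.lpNorm p
        (fun x => Vilenkin.fejer (Vilenkin.martCoeff f) n x - g x)) atTop (𝓝 0)) ∧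
    Tendsto (fun n : ℕ => Vilenkin.martLpNorm p
      (fun k x => Vilenkin.fejer (Vilenkin.coeff (f k)) n x - f k x)) atTop (𝓝 0) := by
  have hq : 0 < 1 / p := one_div_pos.2 hp0
  have hmeas := Vilenkin.measurable_martingale hf.1
  have hE := Vilenkin.tendsto_rpow_zero
    (Vilenkin.tendsto_iSup_lpPow_fejer_martingale_sub hm hbdd hp0 hp1 hf hω) hq
  obtain ⟨g, hg, hlim⟩ := measurable_limit_of_tendsto_metrizable_ae
    (fun k => (hmeas k).aemeasurable)
    (Vilenkin.ae_exists_tendsto_martingale hm hf.1 hp0 (Vilenkin.tendsto_modulus_rpow hω))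
  have hgfin : Vilenkin.lpPow p g < ∞ :=
    ((Vilenkin.lpPow_le_iSup_of_ae_tendsto hmeas hlim).trans
      (iSup_le (Vilenkin.lpPow_le_hpNorm_rpow hp0 f))).trans_lt
      (ENNReal.rpow_lt_top_of_nonneg hp0.le hf.2.ne)
  refine ⟨⟨g, hg, ENNReal.rpow_lt_top_of_nonneg hq.le hgfin.ne, hlim, ?_⟩, ?_⟩
  · exact tendsto_of_tendsto_of_tendsto_of_le_of_le tendsto_const_nhds hE (fun _ => zero_le)
      fun n => ENNReal.rpow_le_rpow (Vilenkin.lpPow_fejer_martCoeff_sub_le hm hf.1 hlim n) hq.le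
  · exact tendsto_of_tendsto_of_tendsto_of_le_of_le tendsto_const_nhds hE (fun _ => zero_le)
      fun n => iSup_le fun k => ENNReal.rpow_le_rpow (le_iSup (fun k => Vilenkin.lpPow p
        fun x => Vilenkin.fejer (Vilenkin.coeff (f k)) n x - f k x) k) hq.le

/-- `‖σ_n f - f‖_p → 0` is asserted in both of its senses: for the function `g` to which the
martingale `f` converges almost everywhere, and for the martingale `σ_n f - f`, whose components
are `σ_n f^{(k)} - f^{(k)}`. -/
theorem theorem1 (m : ℕ → ℕ) [∀ k, NeZero (m k)] (hm : ∀ k, 2 ≤ m k)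
    (hbdd : ∃ C : ℕ, ∀ k, m k ≤ C) (p : ℝ) (hp0 : 0 < p) (hp : p ≤ 1 / 2)
    (f : ℕ → Vilenkin.G m → ℂ) (hf : Vilenkin.MemHp p f)
    (hω : (fun N : ℕ => (Vilenkin.modulus p f N).toReal) =o[atTop]
      fun N : ℕ => 1 / ((Vilenkin.M m N : ℝ) ^ (1 / p - 2) * (N : ℝ) ^ (2 * ⌊1 / 2 + p⌋₊))) :
    (∃ g : Vilenkin.G m → ℂ, Measurable g ∧ Vilenkin.lpNorm p g < ∞ ∧
      (∀ᵐ x ∂Vilenkin.haar m, Tendsto (fun k => f k x) atTop (𝓝 (g x))) ∧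
      Tendsto (fun n : ℕ => Vilenkin.lpNorm p
        (fun x => Vilenkin.fejer (Vilenkin.martCoeff f) n x - g x)) atTop (𝓝 0)) ∧
    Tendsto (fun n : ℕ => Vilenkin.martLpNorm p
      (fun k x => Vilenkin.fejer (Vilenkin.coeff (f k)) n x - f k x)) atTop (𝓝 0) := by
  exact theorem1_general m hm hbdd p hp0 (by linarith) f hf
    (Vilenkin.tendsto_fejerWeight_mul_modulus hm hp0 hp hf hω)
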